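/- Let $d\ge 2$, $c\in\mathbb{C}$ and $f_c(z)=z^d+c$, with filled-in Julia set $K(f_c)$ (the set of points with bounded forward orbit). Let $\phi_c$ be the Böttcher coordinate of $f_c$, i.e. the conformal map near $\infty$ with $\phi_c(z)/z\to 1$ as $z\to\infty$ and $\phi_c\circ f_c=\phi_c^{\,d}$. For $t\in\mathbb{R}/\mathbb{Z}$, the dynamical ray $\mathcal{R}_t$ is the preimage under $\phi_c$ of the radial line $\{e^{s+2\pi i t}\}$, continued from $\infty$ towards $K(f_c)$ for as long as it does not run into a critical point of an iterate of $f_c$; it lands at $z$ if $\overline{\mathcal{R}_t}\cap K(f_c)=\{z\}$. Let $\mathcal{O}=\{z_1,\dots,z_p\}$ be a periodic orbit of $f_c$ of exact period $p$, with $f_c(z_j)=z_{j+1}$ (indices modulo $p$), and assume that at least one dynamical ray at a rational angle lands at some $z_j$. Let $\mathcal{A}_j\subset\mathbb{R}/\mathbb{Z}$ be the set of the angles of all the dynamical rays landing at $z_j$; the collection $\{\mathcal{A}_1,\dots,\mathcal{A}_p\}$ is the orbit portrait of $\mathcal{O}$. Then: 1. Each $\mathcal{A}_j$ is a non-empty finite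 subset of $\mathbb{Q}/\mathbb{Z}$. 2. The map $\theta\mapsto d\theta$ sends $\mathcal{A}_j$ bijectively onto $\mathcal{A}_{j+1}$ and preserves the cyclic order of the angles. 3. Each $\mathcal{A}_j$ is contained in some arc of $\mathbb{R}/\mathbb{Z}$ of length less than $1/d$. 4. All $\theta\in\bigcup_{j=1}^p\mathcal{A}_j$ are periodic under multiplication by $d$, with a common exact period $rp$ for some integer $r\ge 1$. 5. For every $i$, the translated sets $\mathcal{A}_i+j/d$ ($j=0,1,\dots,d-1$) are pairwise unlinked, and each of them is unlinked from every $\mathcal{A}_m$ with $m\ne i$. Here two subsets of $\mathbb{R}/\mathbb{Z}$ are called unlinked if they are contained in disjoint connected subsets of $\mathbb{R}/\mathbb{Z}$. -/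

import Mathlib

open Set Filter Topology

noncomputable section

namespace Unicritical

/-- The unicritical polynomial `f_c(z) = z ^ d + c`, whose only critical point is `0`. -/
def f (d : ℕ) (c : ℂ) (z : ℂ) : ℂ := z ^ d + c

/-- The filled-in Julia set of `f_c`: the points with bounded forward orbit. -/
def filledJulia (d : ℕ) (c : ℂ) : Set ℂ :=
  {z | Bornology.IsBounded (range fun n : ℕ => (f d c)^[n] z)}

/-- A disc neighbourhood of infinity that `f_c` maps into itself, in which every orbit escapes and
on which `|c / z ^ d| < 1`. -/
def nearInfinity (c : ℂ) : Set ℂ := {z | 1 + ‖c‖ < ‖z‖}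

/-- The Böttcher coordinate of `f_c` near infinity,
`φ_c(z) = z * ∏ₙ (f_c^[n+1](z) / f_c^[n](z) ^ d) ^ (1 / d ^ (n + 1))`
with principal roots, where `f_c(w) / w ^ d = 1 + c / w ^ d`.
It is the unique germ of a conformal map at infinity with `φ_c(z) / z → 1` and
`φ_c(f_c(z)) = φ_c(z) ^ d`.  It is only used on `nearInfinity c`. -/
def bottcher (d : ℕ) (c : ℂ) (z : ℂ) : ℂ :=
  z * ∏' n : ℕ, (1 + c / ((f d c)^[n] z) ^ d) ^ ((1 : ℂ) / (d : ℂ) ^ (n + 1))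

/-- The point `exp (s + 2πit)` with potential `s` on the radial line at angle `t ∈ ℝ/ℤ`. -/
def radial (s : ℝ) (t : UnitAddCircle) : ℂ := (Real.exp s : ℂ) * (AddCircle.toCircle t : ℂ)

/-- `γ` parametrizes, by the potential `s > s₀`, the part above potential `s₀` of the preimage of
the radial line at angle `t` under (the analytic continuation from infinity of) `φ_c`.
The curve starts at infinity as the preimage under `φ_c` itself, it passes through no critical
point of any iterate of `f_c`, and `φ_c(γ(s)) = exp (s + 2πit)` along it; in view of
`φ_c ∘ f_c^[n] = φ_c ^ (d ^ n)` the last condition for the continued `φ_c` reads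
`φ_c(f_c^[n](γ(s))) = exp (d ^ n * (s + 2πit))` for all large `n`. -/
structure IsRayAbove (d : ℕ) (c : ℂ) (t : UnitAddCircle) (s₀ : ℝ) (γ : ℝ → ℂ) : Prop where
  continuousOn : ContinuousOn γ (Ioi s₀)
  near_infinity : ∀ᶠ s in atTop, γ s ∈ nearInfinity c ∧ bottcher d c (γ s) = radial s t
  noncritical : ∀ s, s₀ < s → ∀ n : ℕ, (f d c)^[n] (γ s) ≠ 0
  continuation : ∀ s, s₀ < s → ∀ᶠ n : ℕ in atTop,
    (f d c)^[n] (γ s) ∈ nearInfinity c ∧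
      bottcher d c ((f d c)^[n] (γ s)) = radial ((d : ℝ) ^ n * s) (d ^ n • t)

/-- The dynamical ray of `f_c` at angle `t`, continued towards the filled-in Julia set as long as
it does not run into a (pre)critical point. -/
def dynamicalRay (d : ℕ) (c : ℂ) (t : UnitAddCircle) : Set ℂ :=
  {w | ∃ (s₀ : ℝ) (γ : ℝ → ℂ), 0 ≤ s₀ ∧ IsRayAbove d c t s₀ γ ∧ ∃ s, s₀ < s ∧ γ s = w}

/-- The dynamical ray at angle `t` lands at `z`: its closure meets the filled-in Julia set
exactly in `z`.  (A ray that runs into a precritical point outside the filled-in Julia set has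
its closure away from that set, so it does not land.) -/
def RayLandsAt (d : ℕ) (c : ℂ) (t : UnitAddCircle) (z : ℂ) : Prop :=
  closure (dynamicalRay d c t) ∩ filledJulia d c = {z}

/-- The set of the angles of all the dynamical rays that land at `z`. -/
def landingAngles (d : ℕ) (c : ℂ) (z : ℂ) : Set UnitAddCircle :=
  {t | RayLandsAt d c t z}

/-- `z` enumerates, with indices modulo `p`, a periodic orbit of `f_c` of exact period `p`. -/
structure IsPeriodicOrbit (d : ℕ) (c : ℂ) (p : ℕ) (z : ZMod p → ℂ) : Prop where
  pos : 0 < p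
  injective : Function.Injective z
  map : ∀ j, f d c (z j) = z (j + 1)

/-- The orbit portrait of a periodic orbit: the sets `𝒜_j` of the angles of all the rays landing
at the points `z_j`. -/
def orbitPortrait (d : ℕ) (c : ℂ) {p : ℕ} (z : ZMod p → ℂ) (j : ZMod p) : Set UnitAddCircle :=
  landingAngles d c (z j)

/-- The angle `t ∈ ℝ/ℤ` is rational. -/
def IsRationalAngle (t : UnitAddCircle) : Prop := ∃ q : ℚ, ((q : ℝ) : UnitAddCircle) = t

/-- The open arc of `ℝ/ℤ` that is the image of the interval `(a, b)`; its length is `b - a`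
if `a ≤ b ≤ a + 1`. -/
def arc (a b : ℝ) : Set UnitAddCircle := (fun x : ℝ => (x : UnitAddCircle)) '' Ioo a b

/-- Two subsets of the circle are unlinked if they are contained in disjoint connected
subsets of the circle. -/
def Unlinked (S T : Set UnitAddCircle) : Prop :=
  ∃ I J : Set UnitAddCircle,
    IsPreconnected I ∧ IsPreconnected J ∧ Disjoint I J ∧ S ⊆ I ∧ T ⊆ J

/-- The translate `S + j/d` of a set of angles. -/
def translate (d j : ℕ) (S : Set UnitAddCircle) : Set UnitAddCircle :=
  (fun θ => θ + (((j : ℝ) / (d : ℝ) : ℝ) : UnitAddCircle)) '' S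

end Unicritical

end

noncomputable section

namespace Unicritical

/-! ### A crossing lemma for two curves in the plane with prescribed directions at infinity -/

/-! Everything rests on one planar fact: two rays landing at `z` and two rays landing at `w ≠ z`
cannot alternate at infinity (`not_linked`). Two rays with a common landing point join to a curve.
Two such curves with alternating directions would meet (`exists_intersection_of_linked`, a winding
number count), whereas rays at distinct angles are disjoint and a ray has only one landing point.

Since `f_c` is unchanged under multiplication of the variable by `exp (2πi/d)`, rotation by `1/d`
carries the rays landing at `z ≠ 0` to rays landing at a different point; `0` is excluded because no
ray lands at a superattracting point. That the angles at `z` are unlinked from their rotated copies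
forces them to have lifts at mutual distance less than `1/d` (`exists_lift`). Multiplication by `d`
is therefore injective on these angles and preserves their cyclic order.

The rational ray provides at each point of the orbit an angle `θ` fixed by some power `N` of `d`. On
the circle cut at `θ`, multiplication by `N` acts on the other angles at this point as an increasing
map. The orbit of such an angle is monotone, hence convergent, but its small increments are
multiplied by `N`, so it is constant (`smul_eq_of_sbtw_preserving`). Thus all the angles at the
point are `(N - 1)`-torsion, which gives finiteness, rationality and the common period. The
unlinkedness of the translates is `not_linked` again, for the rotated landing points.

Two tools handle the rays themselves. The Green function extends the potential continuously to the
plane and vanishes exactly on the filled-in Julia set. Branches of roots and logarithms are fixed by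
the principle that a continuous function with countably many values on a connected set is constant.
-/

theorem _root_.IsPreconnected.eq_of_countable_image {X Y : Type*} [TopologicalSpace X]
    [MetricSpace Y] {s : Set X} (hs : IsPreconnected s) {g : X → Y} (hg : ContinuousOn g s)
    {C : Set Y} (hC : C.Countable) (hgC : MapsTo g s C) {x y : X} (hx : x ∈ s) (hy : y ∈ s) :
    g x = g y :=
  hC.isTotallyDisconnected (g '' s) hgC.image_subset (hs.image g hg)
    (mem_image_of_mem g hx) (mem_image_of_mem g hy)

/-- The point `exp (2πiθ)` of the unit circle. -/
def unit (θ : ℝ) : ℂ := Complex.exp ((2 * Real.pi * θ : ℝ) * Complex.I)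

theorem unit_add (α β : ℝ) : unit (α + β) = unit α * unit β := by
  simp only [unit, ← Complex.exp_add]; congr 1; push_cast; ring

theorem unit_intCast (k : ℤ) : unit k = 1 := by
  rw [unit, Complex.exp_eq_one_iff]; exact ⟨k, by push_cast; ring⟩

theorem norm_unit (θ : ℝ) : ‖unit θ‖ = 1 := Complex.norm_exp_ofReal_mul_I _

theorem unit_ne_zero (θ : ℝ) : unit θ ≠ 0 := Complex.exp_ne_zero _

theorem conj_unit (θ : ℝ) : (starRingEnd ℂ) (unit θ) = unit (-θ) := by
  rw [unit, unit, ← Complex.exp_conj, map_mul, Complex.conj_I, Complex.conj_ofReal]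
  congr 1; push_cast; ring

theorem unit_mul_conj_unit (α β : ℝ) :
    unit β * (starRingEnd ℂ) (unit α) = unit (β - α) := by
  rw [conj_unit, ← unit_add, sub_eq_add_neg]

theorem one_sub_unit (θ : ℝ) :
    1 - unit θ = (2 * Real.sin (Real.pi * θ) : ℝ) *
      ((Real.sin (Real.pi * θ) : ℝ) + (-Real.cos (Real.pi * θ) : ℝ) * Complex.I) := by
  have h2 : 2 * Real.pi * θ = 2 * (Real.pi * θ) := by ring
  rw [unit, Complex.exp_mul_I, ← Complex.ofReal_cos, ← Complex.ofReal_sin, h2, Real.cos_two_mul,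
    Real.sin_two_mul]
  have := Real.sin_sq_add_cos_sq (Real.pi * θ)
  generalize Real.sin (Real.pi * θ) = S at *
  generalize Real.cos (Real.pi * θ) = C at *
  apply Complex.ext
  · simp [-Complex.ofReal_pow]; linarith
  · simp [-Complex.ofReal_pow]

theorem sin_pi_mul_pos {θ : ℝ} (h0 : 0 < θ) (h1 : θ < 1) : 0 < Real.sin (Real.pi * θ) :=
  Real.sin_pos_of_pos_of_lt_pi (by positivity) (by nlinarith [Real.pi_pos])

theorem arg_one_sub_unit {θ : ℝ} (h0 : 0 < θ) (h1 : θ < 1) :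
    (1 - unit θ).arg = Real.pi * (θ - 1 / 2) := by
  have h : Real.pi * (θ - 1 / 2) = Real.pi * θ - Real.pi / 2 := by ring
  rw [one_sub_unit, ← Real.sin_sub_pi_div_two, ← Real.cos_sub_pi_div_two (Real.pi * θ), ← h,
    Complex.ofReal_cos, Complex.ofReal_sin]
  refine Complex.arg_mul_cos_add_sin_mul_I ?_ ⟨?_, ?_⟩
  · rw [h, Real.cos_sub_pi_div_two]; linarith [sin_pi_mul_pos h0 h1]
  all_goals nlinarith [Real.pi_pos]

theorem re_unit_lt_one {θ : ℝ} (h0 : 0 < θ) (h1 : θ < 1) : (unit θ).re < 1 := by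
  have h := congrArg Complex.re (one_sub_unit θ)
  have hs := sin_pi_mul_pos h0 h1
  generalize Real.sin (Real.pi * θ) = S at *
  generalize -Real.cos (Real.pi * θ) = C at *
  rw [Complex.re_ofReal_mul] at h
  simp at h
  nlinarith


theorem unit_sub_add_int (α β : ℝ) (k : ℤ) : unit (β - α + k) = unit (β - α) := by
  rw [unit_add, unit_intCast, mul_one]

/-- Along a side on which a continuous function stays in a half plane, the increment of its
continuous argument is computed by the principal argument. -/
theorem im_log_increment {Λ F : ℝ → ℂ} (hΛ : Continuous Λ) (hF : ∀ y, Complex.exp (Λ y) = F y)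
    {w : ℂ} {R : ℝ} (hR : 0 ≤ R) (hre : ∀ y ∈ Icc (-R) R, 0 < (F y * w).re) :
    (Λ R).im - (Λ (-R)).im = (F R * w).arg - (F (-R) * w).arg := by
  have hFc : Continuous F := by
    rw [show F = fun y => Complex.exp (Λ y) from funext fun y => (hF y).symm]; fun_prop
  -- `exp D` is the constant `w⁻¹`, so `D` takes values in a translate of `2πiℤ` and does not vary.
  set D : ℝ → ℂ := fun y => Λ y - Complex.log (F y * w) with hD
  have hDc : ContinuousOn D (Icc (-R) R) := by
    refine hΛ.continuousOn.sub (ContinuousOn.clog (by fun_prop) fun y hy => ?_)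
    exact Or.inl (hre y hy)
  have hne : ∀ y ∈ Icc (-R) R, F y * w ≠ 0 := fun y hy h => by
    have := hre y hy; rw [h] at this; simp at this
  have hexp : ∀ y ∈ Icc (-R) R, Complex.exp (D y) = w⁻¹ := fun y hy => by
    have h := hne y hy
    rw [hD]; simp only
    rw [Complex.exp_sub, hF, Complex.exp_log h]
    have h1 := left_ne_zero_of_mul h
    have h2 := right_ne_zero_of_mul h
    field_simp
  have hm : -R ∈ Icc (-R) R := ⟨le_rfl, by linarith⟩
  have hp : R ∈ Icc (-R) R := ⟨by linarith, le_rfl⟩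
  have hC : (range fun n : ℤ => D (-R) + n * (2 * Real.pi * Complex.I)).Countable :=
    countable_range _
  have := isPreconnected_Icc.eq_of_countable_image hDc hC (fun y hy => by
    obtain ⟨n, hn⟩ := Complex.exp_eq_exp_iff_exists_int.1 ((hexp y hy).trans (hexp _ hm).symm)
    exact ⟨n, hn.symm⟩) hp hm
  have := congrArg Complex.im this
  simp only [hD, Complex.sub_im, Complex.log_im] at this
  linarith

/-- The point `a R` has size `exp R` in direction `u`, while the component of `γ y` in that
direction stays below `q * exp R` with `q < 1`: by the asymptotics for large `y`, by compactness for
the rest. This is the half plane condition of `im_log_increment` on one side of a large square. -/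
theorem eventually_half_plane {γ a : ℝ → ℂ} (hγ : Continuous γ) {u v : ℂ}
    (hγv : Tendsto (fun y => γ y / (Real.exp y : ℝ)) atTop (𝓝 v))
    (hau : Tendsto (fun y => a y / (Real.exp y : ℝ)) atTop (𝓝 u)) (hu : ‖u‖ = 1)
    (huv : (v * (starRingEnd ℂ) u).re < 1) :
    ∀ᶠ R in atTop, ∀ y ∈ Icc 0 R, 0 < ((a R - γ y) * (starRingEnd ℂ) u).re := by
  have hcont : ∀ (g : ℝ → ℂ) (b : ℂ), Tendsto (fun y => g y / (Real.exp y : ℝ)) atTop (𝓝 b) →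
      Tendsto (fun y => (g y * (starRingEnd ℂ) u).re / Real.exp y) atTop
        (𝓝 (b * (starRingEnd ℂ) u).re) := fun g b h => by
    have := (Complex.continuous_re.tendsto _).comp (h.mul_const ((starRingEnd ℂ) u))
    refine this.congr fun y => ?_
    rw [Function.comp_apply, div_mul_eq_mul_div, Complex.div_ofReal_re]
  have h1 : (u * (starRingEnd ℂ) u).re = 1 := by
    rw [Complex.mul_conj, Complex.normSq_eq_norm_sq, hu]; simp
  obtain ⟨q, hq, hq1⟩ := exists_between (max_lt huv one_pos)
  have hq0 : 0 < q := (le_max_right _ _).trans_lt hq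
  obtain ⟨Y, hY⟩ := eventually_atTop.1
    ((hcont γ v hγv).eventually_lt_const ((le_max_left _ _).trans_lt hq))
  obtain ⟨M, hM⟩ := (isCompact_Icc (a := 0) (b := Y)).exists_bound_of_continuousOn
    (f := fun y => (γ y * (starRingEnd ℂ) u).re)
    (Continuous.continuousOn (by fun_prop))
  have hev := (hcont a u hau).eventually_const_lt (h1.symm ▸ hq1)
  have hbig : ∀ᶠ R in atTop, M / q < Real.exp R := Real.tendsto_exp_atTop.eventually_gt_atTop _
  filter_upwards [hev, hbig] with R hR hRM y hy
  rw [sub_mul, Complex.sub_re, sub_pos]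
  rw [lt_div_iff₀ (Real.exp_pos _)] at hR
  rw [div_lt_iff₀ hq0] at hRM
  refine lt_of_le_of_lt ?_ hR
  rcases le_total y Y with h | h
  · have := hM y ⟨hy.1, h⟩
    linarith [(Real.le_norm_self _).trans this]
  · have := hY y h
    rw [div_lt_iff₀ (Real.exp_pos _)] at this
    have h3 : Real.exp y ≤ Real.exp R := Real.exp_le_exp.2 hy.2
    nlinarith

/-- After division by `exp R` the corner value tends to `1 - unit (β - α + k)`, whose principal
argument is explicit once `k` brings the angle into `(0, 1)`. -/
theorem tendsto_corner_arg {a b : ℝ → ℂ} {α β : ℝ}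
    (ha : Tendsto (fun y => a y / (Real.exp y : ℝ)) atTop (𝓝 (unit α)))
    (hb : Tendsto (fun y => b y / (Real.exp y : ℝ)) atTop (𝓝 (unit β)))
    (k : ℤ) (h0 : 0 < β - α + k) (h1 : β - α + k < 1) :
    Tendsto (fun R => ((a R - b R) * (starRingEnd ℂ) (unit α)).arg) atTop
      (𝓝 (Real.pi * (β - α + k - 1 / 2))) := by
  have hlim := (ha.sub hb).mul_const ((starRingEnd ℂ) (unit α))
  have he : (unit α - unit β) * (starRingEnd ℂ) (unit α) = 1 - unit (β - α + k) := by
    rw [sub_mul, unit_mul_conj_unit, unit_mul_conj_unit, unit_sub_add_int, sub_self]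
    simp [unit]
  rw [he] at hlim
  have hs : 1 - unit (β - α + k) ∈ Complex.slitPlane :=
    Or.inl (by simpa using re_unit_lt_one h0 h1)
  have := (Complex.continuousAt_arg hs).tendsto.comp hlim
  rw [arg_one_sub_unit h0 h1] at this
  refine this.congr fun R => ?_
  rw [Function.comp_apply, ← sub_div, div_mul_eq_mul_div, div_eq_inv_mul, ← Complex.ofReal_inv,
    Complex.arg_real_mul _ (inv_pos.2 (Real.exp_pos R))]

/-- Two curves in the plane whose ends have linked directions at infinity intersect. -/
theorem exists_intersection_of_linked {Γ₁ Γ₂ : ℝ → ℂ} (h₁ : Continuous Γ₁) (h₂ : Continuous Γ₂)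
    {α₁ α₂ β₁ β₂ : ℝ} (hα₁ : Tendsto (fun y => Γ₁ y / (Real.exp y : ℝ)) atTop (𝓝 (unit α₁)))
    (hα₂ : Tendsto (fun y => Γ₁ (-y) / (Real.exp y : ℝ)) atTop (𝓝 (unit α₂)))
    (hβ₁ : Tendsto (fun y => Γ₂ y / (Real.exp y : ℝ)) atTop (𝓝 (unit β₁)))
    (hβ₂ : Tendsto (fun y => Γ₂ (-y) / (Real.exp y : ℝ)) atTop (𝓝 (unit β₂)))
    (h12 : α₁ < β₁) (h23 : β₁ < α₂) (h34 : α₂ < β₂) (h41 : β₂ < α₁ + 1) :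
    ∃ x y, Γ₁ x = Γ₂ y := by
  by_contra! hne
  -- If the curves are disjoint, `Γ₁ x - Γ₂ y` never vanishes on the simply connected plane and has
  -- a continuous logarithm `Λ` there.
  obtain ⟨Λ, ⟨-, hΛ⟩, -⟩ := Complex.isCoveringMapOn_exp.existsUnique_continuousMap_lifts
    (⟨fun q : ℝ × ℝ => Γ₁ q.1 - Γ₂ q.2, by fun_prop⟩ : C(ℝ × ℝ, ℂ)) (a₀ := ((0 : ℝ), (0 : ℝ)))
    (Complex.exp_log (sub_ne_zero.2 (hne 0 0))) (fun q => sub_ne_zero.2 (hne q.1 q.2))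
  replace hΛ : ∀ x y, Complex.exp (Λ (x, y)) = Γ₁ x - Γ₂ y := fun x y => congrFun hΛ (x, y)
  have hre : ∀ α β : ℝ, ∀ k : ℤ, 0 < β - α + k → β - α + k < 1 →
      (unit β * (starRingEnd ℂ) (unit α)).re < 1 := fun α β k h0 h1 => by
    rw [unit_mul_conj_unit, ← unit_sub_add_int α β k]; exact re_unit_lt_one h0 h1
  have hc₁ : Continuous fun y => Γ₁ (-y) := h₁.comp continuous_neg
  have hc₂ : Continuous fun y => Γ₂ (-y) := h₂.comp continuous_neg
  -- The integers that bring the eight differences into `(0, 1)`; they encode the alternation of the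
  -- four angles.
  have r1 : 0 < β₁ - α₁ + (0 : ℤ) ∧ β₁ - α₁ + (0 : ℤ) < 1 := by constructor <;> simp <;> linarith
  have r2 : 0 < β₂ - α₁ + (0 : ℤ) ∧ β₂ - α₁ + (0 : ℤ) < 1 := by constructor <;> simp <;> linarith
  have t1 : 0 < α₁ - β₁ + (1 : ℤ) ∧ α₁ - β₁ + (1 : ℤ) < 1 := by constructor <;> simp <;> linarith
  have t2 : 0 < α₂ - β₁ + (0 : ℤ) ∧ α₂ - β₁ + (0 : ℤ) < 1 := by constructor <;> simp <;> linarith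
  have l1 : 0 < β₁ - α₂ + (1 : ℤ) ∧ β₁ - α₂ + (1 : ℤ) < 1 := by constructor <;> simp <;> linarith
  have l2 : 0 < β₂ - α₂ + (0 : ℤ) ∧ β₂ - α₂ + (0 : ℤ) < 1 := by constructor <;> simp <;> linarith
  have b1 : 0 < α₁ - β₂ + (1 : ℤ) ∧ α₁ - β₂ + (1 : ℤ) < 1 := by constructor <;> simp <;> linarith
  have b2 : 0 < α₂ - β₂ + (1 : ℤ) ∧ α₂ - β₂ + (1 : ℤ) < 1 := by constructor <;> simp <;> linarith
  -- The increments of `Im Λ` around the boundary of the square `[-R, R]²` add up to `0`; on each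
  -- side they are given by principal arguments at its two corners.
  have key : ∀ᶠ R in atTop,
      ((Γ₁ R - Γ₂ R) * (starRingEnd ℂ) (unit α₁)).arg -
        ((Γ₁ R - Γ₂ (-R)) * (starRingEnd ℂ) (unit α₁)).arg -
      (((Γ₂ R - Γ₁ R) * (starRingEnd ℂ) (unit β₁)).arg -
        ((Γ₂ R - Γ₁ (-R)) * (starRingEnd ℂ) (unit β₁)).arg) -
      (((Γ₁ (-R) - Γ₂ R) * (starRingEnd ℂ) (unit α₂)).arg -
        ((Γ₁ (-R) - Γ₂ (-R)) * (starRingEnd ℂ) (unit α₂)).arg) +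
      (((Γ₂ (-R) - Γ₁ R) * (starRingEnd ℂ) (unit β₂)).arg -
        ((Γ₂ (-R) - Γ₁ (-R)) * (starRingEnd ℂ) (unit β₂)).arg) = 0 := by
    filter_upwards [eventually_ge_atTop 0,
      eventually_half_plane h₂ hβ₁ hα₁ (norm_unit _) (hre _ _ _ r1.1 r1.2),
      eventually_half_plane hc₂ hβ₂ hα₁ (norm_unit _) (hre _ _ _ r2.1 r2.2),
      eventually_half_plane h₁ hα₁ hβ₁ (norm_unit _) (hre _ _ _ t1.1 t1.2),
      eventually_half_plane hc₁ hα₂ hβ₁ (norm_unit _) (hre _ _ _ t2.1 t2.2),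
      eventually_half_plane h₂ hβ₁ hα₂ (norm_unit _) (hre _ _ _ l1.1 l1.2),
      eventually_half_plane hc₂ hβ₂ hα₂ (norm_unit _) (hre _ _ _ l2.1 l2.2),
      eventually_half_plane h₁ hα₁ hβ₂ (norm_unit _) (hre _ _ _ b1.1 b1.2),
      eventually_half_plane hc₁ hα₂ hβ₂ (norm_unit _) (hre _ _ _ b2.1 b2.2)]
      with R hR e1 e2 e3 e4 e5 e6 e7 e8
    have split : ∀ P : ℝ → Prop, (∀ y ∈ Icc 0 R, P y) → (∀ y ∈ Icc 0 R, P (-y)) →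
        ∀ y ∈ Icc (-R) R, P y := fun P hP hN y hy => by
      rcases le_total 0 y with h | h
      · exact hP y ⟨h, hy.2⟩
      · simpa using hN (-y) ⟨by linarith, by linarith [hy.1]⟩
    have s1 := im_log_increment (Λ := fun y => Λ (R, y)) (F := fun y => Γ₁ R - Γ₂ y)
      (by fun_prop) (hΛ R) hR (split _ e1 e2)
    have s2 := im_log_increment (Λ := fun x => Λ (x, R)) (F := fun x => Γ₁ x - Γ₂ R)
      (w := -(starRingEnd ℂ) (unit β₁)) (by fun_prop) (fun x => hΛ x R) hR
      (split _ (by simpa only [mul_neg, ← neg_mul, neg_sub] using e3)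
        (by simpa only [mul_neg, ← neg_mul, neg_sub] using e4))
    have s3 := im_log_increment (Λ := fun y => Λ (-R, y)) (F := fun y => Γ₁ (-R) - Γ₂ y)
      (by fun_prop) (hΛ (-R)) hR (split _ e5 e6)
    have s4 := im_log_increment (Λ := fun x => Λ (x, -R)) (F := fun x => Γ₁ x - Γ₂ (-R))
      (w := -(starRingEnd ℂ) (unit β₂)) (by fun_prop) (fun x => hΛ x (-R)) hR
      (split _ (by simpa only [mul_neg, ← neg_mul, neg_sub] using e7)
        (by simpa only [mul_neg, ← neg_mul, neg_sub] using e8))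
    simp only [mul_neg, ← neg_mul, neg_sub] at s2 s4
    linarith
  have lim := ((((tendsto_corner_arg hα₁ hβ₁ 0 r1.1 r1.2).sub
      (tendsto_corner_arg hα₁ hβ₂ 0 r2.1 r2.2)).sub
    ((tendsto_corner_arg hβ₁ hα₁ 1 t1.1 t1.2).sub (tendsto_corner_arg hβ₁ hα₂ 0 t2.1 t2.2))).sub
    ((tendsto_corner_arg hα₂ hβ₁ 1 l1.1 l1.2).sub (tendsto_corner_arg hα₂ hβ₂ 0 l2.1 l2.2))).add
    ((tendsto_corner_arg hβ₂ hα₁ 1 b1.1 b1.2).sub (tendsto_corner_arg hβ₂ hα₂ 1 b2.1 b2.2))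
  -- All the angles cancel in the sum of the eight limits and `-2π` remains, which is not `0`.
  have := tendsto_nhds_unique (lim.congr' key) tendsto_const_nhds
  push_cast at this
  nlinarith [Real.pi_pos]

/-! ### The Böttcher coordinate near infinity -/

section Bottcher

variable {d : ℕ} {c : ℂ}

theorem one_lt_norm_of_nearInfinity {z : ℂ} (hz : z ∈ nearInfinity c) : 1 < ‖z‖ := by
  have : 1 + ‖c‖ < ‖z‖ := hz
  linarith [norm_nonneg c]

theorem ne_zero_of_nearInfinity {z : ℂ} (hz : z ∈ nearInfinity c) : z ≠ 0 :=
  norm_pos_iff.1 (one_pos.trans (one_lt_norm_of_nearInfinity hz))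

theorem isOpen_nearInfinity : IsOpen (nearInfinity c) :=
  isOpen_lt continuous_const continuous_norm

theorem norm_sq_le_norm_pow (hd : 2 ≤ d) {z : ℂ} (hz : z ∈ nearInfinity c) :
    ‖z‖ ^ 2 ≤ ‖z‖ ^ d :=
  pow_le_pow_right₀ (one_lt_norm_of_nearInfinity hz).le hd

theorem continuous_f : Continuous (f d c) := by unfold f; fun_prop

theorem continuous_iterate_f (n : ℕ) : Continuous (f d c)^[n] := continuous_f.iterate n

theorem differentiable_iterate_f (n : ℕ) : Differentiable ℂ (f d c)^[n] := by
  have : Differentiable ℂ (f d c) := by unfold f; fun_prop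
  exact this.iterate n

theorem norm_le_norm_f (hd : 2 ≤ d) {z : ℂ} (hz : z ∈ nearInfinity c) : ‖z‖ ≤ ‖f d c z‖ := by
  have h1 := norm_sq_le_norm_pow hd hz
  have h2 : ‖z ^ d‖ - ‖c‖ ≤ ‖z ^ d + c‖ := norm_sub_le_norm_add _ _
  have h3 : 1 + ‖c‖ < ‖z‖ := hz
  rw [norm_pow] at h2
  unfold f
  nlinarith [norm_nonneg c]

theorem norm_le_norm_iterate (hd : 2 ≤ d) {z : ℂ} (hz : z ∈ nearInfinity c) (n : ℕ) :
    ‖z‖ ≤ ‖(f d c)^[n] z‖ := by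
  induction n with
  | zero => simp
  | succ n ih =>
    rw [Function.iterate_succ_apply']
    exact ih.trans (norm_le_norm_f hd (lt_of_lt_of_le hz ih))

theorem iterate_mem_nearInfinity (hd : 2 ≤ d) {z : ℂ} (hz : z ∈ nearInfinity c) (n : ℕ) :
    (f d c)^[n] z ∈ nearInfinity c := lt_of_lt_of_le hz (norm_le_norm_iterate hd hz n)

theorem norm_div_pow_le (hd : 2 ≤ d) {z : ℂ} (hz : z ∈ nearInfinity c) :
    ‖c / z ^ d‖ ≤ ‖c‖ / ‖z‖ ^ 2 := by
  rw [norm_div, norm_pow]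
  have := one_lt_norm_of_nearInfinity hz
  exact div_le_div_of_nonneg_left (norm_nonneg c) (by positivity) (norm_sq_le_norm_pow hd hz)

theorem norm_div_sq_le {z : ℂ} (hz : z ∈ nearInfinity c) : ‖c‖ / ‖z‖ ^ 2 ≤ 1 / 4 := by
  have h0 := one_lt_norm_of_nearInfinity hz
  have h3 : 1 + ‖c‖ < ‖z‖ := hz
  rw [div_le_iff₀ (by positivity)]
  -- This is `4‖c‖ ≤ (1 + ‖c‖)² ≤ ‖z‖²`.
  nlinarith [norm_nonneg c, sq_nonneg (1 - ‖c‖)]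

theorem norm_div_pow_le_quarter (hd : 2 ≤ d) {z : ℂ} (hz : z ∈ nearInfinity c) :
    ‖c / z ^ d‖ ≤ 1 / 4 := (norm_div_pow_le hd hz).trans (norm_div_sq_le hz)

theorem one_add_div_pow_mem_slitPlane (hd : 2 ≤ d) {z : ℂ} (hz : z ∈ nearInfinity c) :
    1 + c / z ^ d ∈ Complex.slitPlane :=
  Complex.mem_slitPlane_of_norm_lt_one (by linarith [norm_div_pow_le_quarter hd hz])

/-- The terms of the series of the logarithm of `φ_c(z) / z`. -/
def logTerm (d : ℕ) (c : ℂ) (n : ℕ) (z : ℂ) : ℂ :=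
  Complex.log (1 + c / ((f d c)^[n] z) ^ d) * ((1 : ℂ) / (d : ℂ) ^ (n + 1))

/-- The logarithm of `φ_c(z) / z`. -/
def logBottcher (d : ℕ) (c : ℂ) (z : ℂ) : ℂ := ∑' n, logTerm d c n z

theorem norm_logTerm_le (hd : 2 ≤ d) {z : ℂ} (hz : z ∈ nearInfinity c) (n : ℕ) :
    ‖logTerm d c n z‖ ≤ 3 / 2 * (‖c‖ / ‖z‖ ^ 2) * (1 / 2) ^ (n + 1) := by
  have hn := iterate_mem_nearInfinity hd hz n
  have h1 := norm_div_pow_le_quarter hd hn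
  have h2 := Complex.norm_log_one_add_half_le_self (h1.trans (by norm_num))
  have h0 := one_lt_norm_of_nearInfinity hz
  have h3 : ‖c‖ / ‖(f d c)^[n] z‖ ^ 2 ≤ ‖c‖ / ‖z‖ ^ 2 :=
    div_le_div_of_nonneg_left (norm_nonneg c) (by positivity)
      (pow_le_pow_left₀ (norm_nonneg z) (norm_le_norm_iterate hd hz n) 2)
  have h4 := norm_div_pow_le hd hn
  have h5 : ‖(1 : ℂ) / (d : ℂ) ^ (n + 1)‖ ≤ (1 / 2) ^ (n + 1) := by
    rw [norm_div, norm_pow, Complex.norm_natCast, norm_one, one_div_pow]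
    have : (2 : ℝ) ≤ d := by exact_mod_cast hd
    gcongr
  rw [logTerm, norm_mul]
  gcongr
  linarith

theorem summable_half_pow_succ : Summable fun n : ℕ => ((1 : ℝ) / 2) ^ (n + 1) :=
  (summable_nat_add_iff 1).2 summable_geometric_two

theorem tsum_half_pow_succ : ∑' n : ℕ, ((1 : ℝ) / 2) ^ (n + 1) = 1 := by
  simp only [pow_succ]
  rw [tsum_mul_right, tsum_geometric_two]; norm_num

theorem summable_logTerm (hd : 2 ≤ d) {z : ℂ} (hz : z ∈ nearInfinity c) :
    Summable fun n => logTerm d c n z :=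
  .of_norm_bounded (summable_half_pow_succ.mul_left _) (norm_logTerm_le hd hz)

theorem norm_logBottcher_le (hd : 2 ≤ d) {z : ℂ} (hz : z ∈ nearInfinity c) :
    ‖logBottcher d c z‖ ≤ 3 / 2 * (‖c‖ / ‖z‖ ^ 2) := by
  have := tsum_of_norm_bounded (summable_half_pow_succ.mul_left (3 / 2 * (‖c‖ / ‖z‖ ^ 2))).hasSum
    (norm_logTerm_le hd hz)
  rwa [tsum_mul_left, tsum_half_pow_succ, mul_one] at this

theorem norm_logBottcher_le_one (hd : 2 ≤ d) {z : ℂ} (hz : z ∈ nearInfinity c) :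
    ‖logBottcher d c z‖ ≤ 1 := by
  linarith [norm_logBottcher_le hd hz, norm_div_sq_le hz]

theorem bottcher_eq (hd : 2 ≤ d) {z : ℂ} (hz : z ∈ nearInfinity c) :
    bottcher d c z = z * Complex.exp (logBottcher d c z) := by
  rw [bottcher, logBottcher, ← (summable_logTerm hd hz).hasSum.cexp.tprod_eq]
  congr 2
  funext n
  have := Complex.slitPlane_ne_zero
    (one_add_div_pow_mem_slitPlane hd (iterate_mem_nearInfinity hd hz n))
  rw [Complex.cpow_def_of_ne_zero this]; rfl

theorem logBottcher_f (hd : 2 ≤ d) {z : ℂ} (hz : z ∈ nearInfinity c) :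
    logBottcher d c (f d c z) = d * logBottcher d c z - Complex.log (1 + c / z ^ d) := by
  have hd0 : (d : ℂ) ≠ 0 := by exact_mod_cast (by omega : d ≠ 0)
  have h := (summable_logTerm hd hz).tsum_eq_zero_add
  have h1 : ∀ n, logTerm d c n (f d c z) = d * logTerm d c (n + 1) z := fun n => by
    rw [logTerm, logTerm, Function.iterate_succ_apply, pow_succ _ (n + 1)]
    field_simp
  rw [logBottcher, logBottcher, h, tsum_congr h1, tsum_mul_left, logTerm]
  simp only [Function.iterate_zero, id_eq]
  field_simp
  ring

theorem bottcher_f (hd : 2 ≤ d) {z : ℂ} (hz : z ∈ nearInfinity c) :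
    bottcher d c (f d c z) = bottcher d c z ^ d := by
  have h0 := Complex.slitPlane_ne_zero (one_add_div_pow_mem_slitPlane hd hz)
  have hz0 := ne_zero_of_nearInfinity hz
  rw [bottcher_eq hd hz, bottcher_eq hd (show f d c z ∈ nearInfinity c from iterate_mem_nearInfinity hd hz 1),
    logBottcher_f hd hz, Complex.exp_sub, Complex.exp_log h0, mul_pow, ← Complex.exp_nat_mul]
  have : f d c z = z ^ d * (1 + c / z ^ d) := by
    rw [f]; field_simp
  rw [this]
  clear this
  generalize 1 + c / z ^ d = q at *
  field_simp

theorem bottcher_iterate (hd : 2 ≤ d) {z : ℂ} (hz : z ∈ nearInfinity c) (n : ℕ) :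
    bottcher d c ((f d c)^[n] z) = bottcher d c z ^ d ^ n := by
  induction n with
  | zero => simp
  | succ n ih =>
    rw [Function.iterate_succ_apply', bottcher_f hd (iterate_mem_nearInfinity hd hz n), ih,
      ← pow_mul, pow_succ]

theorem differentiableOn_logBottcher (hd : 2 ≤ d) :
    DifferentiableOn ℂ (logBottcher d c) (nearInfinity c) := by
  refine Complex.differentiableOn_tsum_of_summable_norm
    (u := fun n => 1 * (1 / 2) ^ (n + 1)) (summable_half_pow_succ.mul_left _) (fun n => ?_)
    isOpen_nearInfinity (fun n z hz => (norm_logTerm_le hd hz n).trans ?_)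
  · refine DifferentiableOn.mul_const (DifferentiableOn.clog ?_ fun z hz =>
      one_add_div_pow_mem_slitPlane hd (iterate_mem_nearInfinity hd hz n)) _
    refine (DifferentiableOn.div (by fun_prop)
      ((differentiable_iterate_f n).differentiableOn.pow d) fun z hz => ?_).const_add _
    exact pow_ne_zero _ (ne_zero_of_nearInfinity (iterate_mem_nearInfinity hd hz n))
  · gcongr
    linarith [norm_div_sq_le hz]

theorem continuousOn_bottcher (hd : 2 ≤ d) : ContinuousOn (bottcher d c) (nearInfinity c) := by
  have : ContinuousOn (fun z => z * Complex.exp (logBottcher d c z)) (nearInfinity c) :=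
    continuousOn_id.mul (differentiableOn_logBottcher hd).continuousOn.cexp
  exact this.congr fun z hz => bottcher_eq hd hz

theorem abs_log_norm_bottcher_sub (hd : 2 ≤ d) {z : ℂ} (hz : z ∈ nearInfinity c) :
    |Real.log ‖bottcher d c z‖ - Real.log ‖z‖| ≤ 1 := by
  have h0 := norm_pos_iff.2 (ne_zero_of_nearInfinity hz)
  rw [bottcher_eq hd hz, norm_mul, Complex.norm_exp, Real.log_mul h0.ne' (Real.exp_pos _).ne',
    Real.log_exp, add_sub_cancel_left]
  exact (Complex.abs_re_le_norm _).trans (norm_logBottcher_le_one hd hz)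

theorem tendsto_logBottcher (hd : 2 ≤ d) :
    Tendsto (logBottcher d c) (Bornology.cobounded ℂ) (𝓝 0) := by
  have h : Tendsto (fun z : ℂ => 3 / 2 * (‖c‖ / ‖z‖ ^ 2)) (Bornology.cobounded ℂ) (𝓝 0) := by
    have h1 : Tendsto (fun x : ℝ => 3 / 2 * (‖c‖ / x ^ 2)) atTop (𝓝 (3 / 2 * 0)) :=
      ((tendsto_pow_atTop two_ne_zero).const_div_atTop _).const_mul _
    rw [mul_zero] at h1
    exact h1.comp tendsto_norm_cobounded_atTop
  refine squeeze_zero_norm' ?_ h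
  filter_upwards [tendsto_norm_cobounded_atTop.eventually_gt_atTop (1 + ‖c‖)] with z hz
  exact norm_logBottcher_le hd hz

/-- The Böttcher coordinate is injective near infinity. -/
theorem exists_injOn_bottcher (hd : 2 ≤ d) :
    ∃ R, 1 + ‖c‖ ≤ R ∧ InjOn (bottcher d c) {z | R < ‖z‖} := by
  -- In the coordinate `ζ = 1 / z` the logarithm has a removable singularity at `0` with value `0`.
  -- So `1 / φ_c` becomes `ζ * exp (-M ζ)`, with derivative `1` at `0`, and the inverse function
  -- theorem applies.
  set M : ℂ → ℂ := Function.update (fun ζ => logBottcher d c ζ⁻¹) 0 0 with hM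
  set r : ℝ := (1 + ‖c‖)⁻¹
  have hr : 0 < r := inv_pos.2 (by positivity)
  have hball : Metric.ball (0 : ℂ) r ∈ 𝓝 0 := Metric.ball_mem_nhds _ hr
  have hinv : ∀ ζ ∈ Metric.ball (0 : ℂ) r \ {0}, ζ⁻¹ ∈ nearInfinity c := fun ζ hζ => by
    have h1 : ‖ζ‖ < r := by simpa using hζ.1
    have h2 : 0 < ‖ζ‖ := norm_pos_iff.2 hζ.2
    change 1 + ‖c‖ < ‖ζ⁻¹‖
    rw [norm_inv]
    exact (lt_inv_comm₀ h2 (by positivity)).1 h1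
  have hcont : ContinuousAt M 0 := by
    rw [hM, continuousAt_update_same]
    exact (tendsto_logBottcher hd).comp tendsto_inv₀_nhdsNE_zero
  have hdiff : DifferentiableOn ℂ M (Metric.ball 0 r) := by
    rw [← Complex.differentiableOn_compl_singleton_and_continuousAt_iff hball]
    refine ⟨?_, hcont⟩
    have : DifferentiableOn ℂ (fun ζ : ℂ => logBottcher d c ζ⁻¹) (Metric.ball 0 r \ {0}) :=
      (differentiableOn_logBottcher hd).comp
        (differentiableOn_inv.mono fun ζ hζ => hζ.2) hinv
    exact this.congr fun ζ hζ => by rw [hM, Function.update_of_ne hζ.2]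
  have hMa : AnalyticAt ℂ M 0 := hdiff.analyticAt hball
  have hM0 : M 0 = 0 := by simp [hM]
  have hψ : HasStrictDerivAt (fun ζ => ζ * Complex.exp (-M ζ)) 1 0 := by
    have h1 := (hasStrictDerivAt_id (0 : ℂ)).mul hMa.hasStrictDerivAt.neg.cexp
    convert! h1 using 1
    simp [hM0]
  have hinj := hψ.hasStrictFDerivAt_equiv one_ne_zero
  obtain ⟨ε, hε, hleft⟩ := Metric.eventually_nhds_iff.1 hinj.eventually_left_inverse
  refine ⟨max (1 + ‖c‖) ε⁻¹, le_max_left _ _, fun z hz w hw h => ?_⟩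
  have hmem : ∀ z : ℂ, max (1 + ‖c‖) ε⁻¹ < ‖z‖ → z ∈ nearInfinity c ∧ dist z⁻¹ 0 < ε :=
    fun z hz => by
      have h1 := (le_max_right _ _).trans_lt hz
      refine ⟨(le_max_left _ _).trans_lt hz, ?_⟩
      rw [dist_zero_right, norm_inv]
      exact inv_lt_of_inv_lt₀ hε h1
  have heq : ∀ z ∈ nearInfinity c, z⁻¹ * Complex.exp (-M z⁻¹) = (bottcher d c z)⁻¹ := fun z hz => by
    rw [bottcher_eq hd hz, hM, Function.update_of_ne (inv_ne_zero (ne_zero_of_nearInfinity hz)),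
      inv_inv, mul_inv, Complex.exp_neg]
  have hz' := hmem z hz
  have hw' := hmem w hw
  have h1 := hleft hz'.2
  have h2 := hleft hw'.2
  rw [heq z hz'.1] at h1
  rw [heq w hw'.1, ← h, h1] at h2
  exact inv_injective h2

end Bottcher

/-! ### The Green function -/

section Green

variable {d : ℕ} {c : ℂ}

/-- A continuous function that agrees with `log ‖v‖` near infinity. -/
def logNorm (c v : ℂ) : ℝ := Real.log (max (1 + ‖c‖) ‖v‖)

/-- The Green function of the filled-in Julia set. -/
def green (d : ℕ) (c w : ℂ) : ℝ :=
  logNorm c w + ∑' n : ℕ,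
    (logNorm c ((f d c)^[n + 1] w) / d - logNorm c ((f d c)^[n] w)) / d ^ n

theorem one_le_max (c v : ℂ) : 1 ≤ max (1 + ‖c‖) ‖v‖ :=
  le_max_of_le_left (by linarith [norm_nonneg c])

theorem continuous_logNorm : Continuous (logNorm c) :=
  Continuous.log (by fun_prop) fun v => (zero_lt_one.trans_le (one_le_max c v)).ne'

/-- The truncation in `logNorm` makes this bound uniform on the whole plane. Hence the series of the
Green function converges uniformly, and `green` is continuous up to and across the filled-in Julia
set. -/
theorem abs_logNorm_f_sub (hd : 2 ≤ d) (v : ℂ) :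
    |logNorm c (f d c v) - d * logNorm c v| ≤ Real.log 2 + d * Real.log (1 + ‖c‖) := by
  set ρ := max (1 + ‖c‖) ‖v‖ with hρ
  have hρ1 : 1 ≤ ρ := one_le_max c v
  have hρ0 : 0 < ρ := zero_lt_one.trans_le hρ1
  have hc0 := norm_nonneg c
  have hcρ : 1 + ‖c‖ ≤ ρ := le_max_left _ _
  have hpow : ρ ≤ ρ ^ d := le_self_pow₀ hρ1 (by omega)
  have hlog : d * logNorm c v = Real.log (ρ ^ d) := by rw [Real.log_pow]; rfl
  have hR : 0 ≤ Real.log (1 + ‖c‖) := Real.log_nonneg (by linarith)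
  have hl2 : 0 < Real.log 2 := Real.log_pos one_lt_two
  rw [abs_sub_le_iff, hlog]
  constructor
  · have : max (1 + ‖c‖) ‖f d c v‖ ≤ 2 * ρ ^ d := by
      refine max_le (by linarith) ?_
      calc ‖v ^ d + c‖ ≤ ‖v‖ ^ d + ‖c‖ := by simpa using norm_add_le (v ^ d) c
        _ ≤ ρ ^ d + ‖c‖ := by gcongr; exact le_max_right _ _
        _ ≤ 2 * ρ ^ d := by linarith
    have h := Real.log_le_log (zero_lt_one.trans_le (one_le_max c _)) this
    rw [Real.log_mul two_ne_zero (by positivity)] at h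
    have : 0 ≤ d * Real.log (1 + ‖c‖) := by positivity
    rw [logNorm]; linarith
  · rcases le_or_gt ‖v‖ (1 + ‖c‖) with h | h
    · have : ρ = 1 + ‖c‖ := max_eq_left h
      have h2 : 0 ≤ logNorm c (f d c v) := Real.log_nonneg (one_le_max c _)
      rw [Real.log_pow, this]; linarith
    · have hv : v ∈ nearInfinity c := h
      have h1 : ρ = ‖v‖ := max_eq_right h.le
      have h2 : ‖v‖ ^ d / 2 ≤ max (1 + ‖c‖) ‖f d c v‖ := by
        refine le_max_of_le_right ?_
        have h3 : ‖v ^ d‖ - ‖c‖ ≤ ‖v ^ d + c‖ := norm_sub_le_norm_add _ _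
        have h4 := norm_sq_le_norm_pow hd hv
        rw [norm_pow] at h3
        unfold f
        nlinarith [sq_nonneg (‖c‖ - 1)]
      have h3 := Real.log_le_log (by rw [← h1]; positivity) h2
      rw [← h1, Real.log_div (by positivity) two_ne_zero] at h3
      have : 0 ≤ d * Real.log (1 + ‖c‖) := by positivity
      rw [logNorm]; linarith

/-- A bound for the terms of the series that defines the Green function. -/
def greenBound (d : ℕ) (c : ℂ) : ℝ := Real.log 2 + d * Real.log (1 + ‖c‖)

theorem abs_greenTerm_le (hd : 2 ≤ d) (w : ℂ) (n : ℕ) :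
    |(logNorm c ((f d c)^[n + 1] w) / d - logNorm c ((f d c)^[n] w)) / d ^ n| ≤
      greenBound d c * (1 / 2) ^ n := by
  have hd' : (2 : ℝ) ≤ d := by exact_mod_cast hd
  have h := abs_logNorm_f_sub (c := c) hd ((f d c)^[n] w)
  rw [← Function.iterate_succ_apply' (f d c)] at h
  have hB : 0 ≤ greenBound d c := (abs_nonneg _).trans h
  have e : logNorm c ((f d c)^[n + 1] w) / d - logNorm c ((f d c)^[n] w) =
      (logNorm c ((f d c)^[n + 1] w) - d * logNorm c ((f d c)^[n] w)) / d := by field_simp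
  rw [e, abs_div, abs_div, abs_of_pos (by positivity : (0 : ℝ) < d),
    abs_of_pos (by positivity : (0 : ℝ) < (d : ℝ) ^ n), div_eq_mul_one_div _ ((d : ℝ) ^ n),
    ← one_div_pow]
  gcongr
  · exact (div_le_self (abs_nonneg _) (by linarith)).trans h

theorem continuous_green (hd : 2 ≤ d) : Continuous (green d c) := by
  refine continuous_logNorm.add (continuous_tsum (fun n => ?_)
    (summable_geometric_two.mul_left (greenBound d c)) fun n w => abs_greenTerm_le hd w n)
  have h1 := continuous_logNorm (c := c)
  exact (((h1.comp (continuous_iterate_f _)).div_const _).sub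
    (h1.comp (continuous_iterate_f _))).div_const _

theorem summable_greenTerm (hd : 2 ≤ d) (w : ℂ) : Summable fun n : ℕ =>
    (logNorm c ((f d c)^[n + 1] w) / d - logNorm c ((f d c)^[n] w)) / (d : ℝ) ^ n :=
  .of_norm_bounded (summable_geometric_two.mul_left (greenBound d c)) (abs_greenTerm_le hd w)

theorem abs_green_sub_logNorm (hd : 2 ≤ d) (w : ℂ) :
    |green d c w - logNorm c w| ≤ 2 * greenBound d c := by
  rw [green, add_sub_cancel_left]
  have := tsum_of_norm_bounded (summable_geometric_two.mul_left (greenBound d c)).hasSum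
    (fun n => (Real.norm_eq_abs _).trans_le (abs_greenTerm_le (c := c) hd w n))
  rw [Real.norm_eq_abs] at this
  rwa [tsum_mul_left, tsum_geometric_two, mul_comm] at this

theorem green_f (hd : 2 ≤ d) (w : ℂ) : green d c (f d c w) = d * green d c w := by
  have hd0 : (d : ℝ) ≠ 0 := by exact_mod_cast (by omega : d ≠ 0)
  rw [green, green, (summable_greenTerm hd w).tsum_eq_zero_add]
  have h1 : ∀ n : ℕ,
      (logNorm c ((f d c)^[n + 1] (f d c w)) / d - logNorm c ((f d c)^[n] (f d c w))) / d ^ n =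
      d * ((logNorm c ((f d c)^[n + 1 + 1] w) / d - logNorm c ((f d c)^[n + 1] w)) / d ^ (n + 1)) :=
    fun n => by
      rw [← Function.iterate_succ_apply, ← Function.iterate_succ_apply, pow_succ]
      field_simp
  rw [tsum_congr h1, tsum_mul_left]
  simp only [Function.iterate_succ_apply, Function.iterate_zero, id_eq, pow_zero]
  field_simp
  ring

theorem green_iterate (hd : 2 ≤ d) (w : ℂ) (n : ℕ) :
    green d c ((f d c)^[n] w) = d ^ n * green d c w := by
  induction n with
  | zero => simp
  | succ n ih => rw [Function.iterate_succ_apply', green_f hd, ih, pow_succ]; ring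

/-- The Green function is multiplied by `d ^ n` under `f_c^[n]`, so a comparison that holds along an
orbit up to a bounded error becomes an equality. -/
theorem eq_zero_of_abs_pow_mul_le (hd : 2 ≤ d) {a B : ℝ}
    (h : ∀ᶠ n : ℕ in atTop, |(d : ℝ) ^ n * a| ≤ B) : a = 0 := by
  by_contra ha
  have hd' : (1 : ℝ) < d := by exact_mod_cast (by omega : 1 < d)
  have := ((tendsto_pow_atTop_atTop_of_one_lt hd').atTop_mul_const
    (abs_pos.2 ha)).eventually_gt_atTop B
  obtain ⟨n, hn, hn'⟩ := (h.and this).exists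
  rw [abs_mul, abs_of_pos (by positivity : (0 : ℝ) < (d : ℝ) ^ n)] at hn
  linarith

theorem green_eq_zero (hd : 2 ≤ d) {w : ℂ} (hw : w ∈ filledJulia d c) : green d c w = 0 := by
  obtain ⟨M, hM⟩ := Bornology.IsBounded.exists_norm_le
    (s := range fun n : ℕ => (f d c)^[n] w) hw
  obtain ⟨B, hB⟩ := (isCompact_closedBall (0 : ℂ) M).exists_bound_of_continuousOn
    (continuous_green (c := c) hd).continuousOn
  refine eq_zero_of_abs_pow_mul_le hd (.of_forall fun n => ?_) (B := B)
  rw [← green_iterate hd w n]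
  exact hB _ (by simpa using hM _ ⟨n, rfl⟩)

theorem norm_radial (s : ℝ) (t : UnitAddCircle) : ‖radial s t‖ = Real.exp s := by
  rw [radial, norm_mul, Circle.norm_coe, Complex.norm_real, mul_one, Real.norm_eq_abs,
    abs_of_pos (Real.exp_pos s)]

theorem logNorm_of_nearInfinity {z : ℂ} (hz : z ∈ nearInfinity c) : logNorm c z = Real.log ‖z‖ := by
  rw [logNorm, max_eq_right (le_of_lt hz)]

/-- Near infinity `green` and `log ‖φ_c‖` both differ from `log ‖z‖` by a bounded amount. Only the
modulus of the Böttcher coordinate enters, so the angles `τ` are arbitrary. -/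
theorem green_eq_of_bottcher (hd : 2 ≤ d) {w : ℂ} {s : ℝ} {τ : ℕ → UnitAddCircle}
    (h : ∀ᶠ n : ℕ in atTop, (f d c)^[n] w ∈ nearInfinity c ∧
      bottcher d c ((f d c)^[n] w) = radial ((d : ℝ) ^ n * s) (τ n)) : green d c w = s := by
  rw [← sub_eq_zero]
  refine eq_zero_of_abs_pow_mul_le hd (B := 2 * greenBound d c + 1) ?_
  filter_upwards [h] with n hn
  have h1 := abs_log_norm_bottcher_sub hd hn.1
  have h2 := abs_green_sub_logNorm (c := c) hd ((f d c)^[n] w)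
  rw [hn.2, norm_radial, Real.log_exp] at h1
  rw [green_iterate hd, logNorm_of_nearInfinity hn.1] at h2
  rw [abs_le] at *
  constructor <;> linarith [h1.1, h1.2, h2.1, h2.2]

theorem lt_norm_of_lt_green (hd : 2 ≤ d) {R : ℝ} (hR : 1 + ‖c‖ ≤ R) {w : ℂ}
    (h : Real.log R + 2 * greenBound d c < green d c w) : R < ‖w‖ := by
  have h2 := (abs_le.1 (abs_green_sub_logNorm (c := c) hd w)).2
  have h3 : Real.log R < logNorm c w := by linarith
  have := (Real.log_lt_log_iff (by linarith [norm_nonneg c])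
    (zero_lt_one.trans_le (one_le_max c w))).1 h3
  exact (lt_max_iff.1 this).resolve_left (by linarith)

end Green

/-! ### Dynamical rays -/

section Rays

variable {d : ℕ} {c : ℂ}

theorem radial_pow (s : ℝ) (t : UnitAddCircle) (m : ℕ) :
    radial s t ^ m = radial (m * s) (m • t) := by
  rw [radial, radial, mul_pow, AddCircle.toCircle_nsmul, Real.exp_nat_mul]
  push_cast; rfl

theorem radial_ne_zero (s : ℝ) (t : UnitAddCircle) : radial s t ≠ 0 := by
  rw [← norm_pos_iff, norm_radial]; exact Real.exp_pos s

theorem radial_injective (s : ℝ) : Function.Injective (radial s) := fun t₁ t₂ h => by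
  have h1 : (Real.exp s : ℂ) ≠ 0 := by exact_mod_cast (Real.exp_pos s).ne'
  exact AddCircle.injective_toCircle one_ne_zero (Circle.ext (mul_left_cancel₀ h1 h))

theorem toCircle_coe_eq_unit (x : ℝ) :
    (AddCircle.toCircle (x : UnitAddCircle) : ℂ) = unit x := by
  rw [AddCircle.toCircle_apply_mk, Circle.coe_exp, unit, div_one]

theorem radial_add_coe (s : ℝ) (t : UnitAddCircle) (x : ℝ) :
    radial s (t + (x : UnitAddCircle)) = unit x * radial s t := by
  rw [radial, radial, AddCircle.toCircle_add, Circle.coe_mul, toCircle_coe_eq_unit]; ring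

theorem mem_filledJulia_of_green_eq_zero (hd : 2 ≤ d) {w : ℂ} (h : green d c w = 0) :
    w ∈ filledJulia d c := by
  refine (Metric.isBounded_closedBall (x := (0 : ℂ))
    (r := Real.exp (2 * greenBound d c))).subset ?_
  rintro _ ⟨n, rfl⟩
  have h1 := (abs_le.1 (abs_green_sub_logNorm (c := c) hd ((f d c)^[n] w))).1
  rw [green_iterate hd, h, mul_zero] at h1
  have h2 : logNorm c ((f d c)^[n] w) ≤ 2 * greenBound d c := by linarith
  rw [logNorm, Real.log_le_iff_le_exp (zero_lt_one.trans_le (one_le_max c _))] at h2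
  simpa using (le_max_right _ _).trans h2

theorem norm_le_of_green_le (hd : 2 ≤ d) {w : ℂ} {b : ℝ} (h : green d c w ≤ b) :
    ‖w‖ ≤ Real.exp (b + 2 * greenBound d c) := by
  have h1 := (abs_le.1 (abs_green_sub_logNorm (c := c) hd w)).1
  have h2 : logNorm c w ≤ b + 2 * greenBound d c := by linarith
  rw [logNorm, Real.log_le_iff_le_exp (zero_lt_one.trans_le (one_le_max c _))] at h2
  exact (le_max_right _ _).trans h2

namespace IsRayAbove

variable {t t₁ t₂ : UnitAddCircle} {s₀ s₁ s₂ : ℝ} {γ γ₁ γ₂ : ℝ → ℂ}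

theorem green_eq (hγ : IsRayAbove d c t s₀ γ) (hd : 2 ≤ d) {s : ℝ} (hs : s₀ < s) :
    green d c (γ s) = s := green_eq_of_bottcher hd (hγ.continuation s hs)

theorem eventually_lt_norm (hγ : IsRayAbove d c t s₀ γ) (hd : 2 ≤ d) (R : ℝ) :
    ∀ᶠ s in atTop, R < ‖γ s‖ := by
  filter_upwards [eventually_gt_atTop s₀,
    eventually_gt_atTop (Real.log (max R (1 + ‖c‖)) + 2 * greenBound d c)] with s h1 h2
  rw [← hγ.green_eq hd h1] at h2
  exact (le_max_left _ _).trans_lt (lt_norm_of_lt_green hd (le_max_right _ _) h2)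

/-- A ray is asymptotic to a radial line. -/
theorem tendsto_div_exp (hγ : IsRayAbove d c t s₀ γ) (hd : 2 ≤ d) :
    Tendsto (fun s => γ s / (Real.exp s : ℝ)) atTop (𝓝 (AddCircle.toCircle t : ℂ)) := by
  have h1 : Tendsto γ atTop (Bornology.cobounded ℂ) := by
    rw [← tendsto_norm_atTop_iff_cobounded]
    exact tendsto_atTop_mono' _ ((eventually_gt_atTop s₀).mono fun s _ => le_rfl)
      (tendsto_atTop.2 fun R => (hγ.eventually_lt_norm hd R).mono fun s => le_of_lt)
  have h2 : Tendsto (fun s => (AddCircle.toCircle t : ℂ) *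
      (Complex.exp (logBottcher d c (γ s)))⁻¹) atTop (𝓝 ((AddCircle.toCircle t : ℂ) * 1)) := by
    have := ((tendsto_logBottcher (c := c) hd).comp h1).cexp
    rw [Complex.exp_zero] at this
    have := (this.inv₀ one_ne_zero).const_mul (AddCircle.toCircle t : ℂ)
    rwa [inv_one] at this
  rw [mul_one] at h2
  refine h2.congr' ?_
  filter_upwards [hγ.near_infinity] with s hs
  have h3 := hs.2
  rw [bottcher_eq hd hs.1, radial] at h3
  have h4 : (Real.exp s : ℂ) ≠ 0 := by exact_mod_cast (Real.exp_pos s).ne'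
  have h5 := Complex.exp_ne_zero (logBottcher d c (γ s))
  rw [eq_div_iff h4, mul_comm, ← mul_assoc, ← h3, mul_assoc, mul_inv_cancel₀ h5, mul_one]

theorem _root_.Complex.finite_setOf_pow_eq_one {m : ℕ} (hm : 0 < m) :
    {z : ℂ | z ^ m = 1}.Finite :=
  ((Polynomial.nthRoots m (1 : ℂ)).toFinset.finite_toSet).subset fun z hz => by
    simpa [Polynomial.mem_nthRoots hm] using hz

/-- The Böttcher coordinate of the iterates of a ray point is the expected one as soon as the
potential is large enough. -/
theorem bottcher_iterate_eq (hγ : IsRayAbove d c t s₀ γ) (hd : 2 ≤ d) {R : ℝ}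
    (hR : 1 + ‖c‖ ≤ R) {n : ℕ} {s : ℝ} (hs : s₀ < s)
    (hn : Real.log R + 2 * greenBound d c < d ^ n * s) :
    bottcher d c ((f d c)^[n] (γ s)) = radial ((d : ℝ) ^ n * s) (d ^ n • t) := by
  have hdn : (0 : ℝ) < (d : ℝ) ^ n := by positivity
  set J : Set ℝ := Ioi s₀ ∩ {s | Real.log R + 2 * greenBound d c < d ^ n * s} with hJ
  have hJ' : J = Ioi (max s₀ ((Real.log R + 2 * greenBound d c) / d ^ n)) := by
    ext x
    simp only [hJ, mem_inter_iff, mem_Ioi, mem_ofPred_eq, max_lt_iff, div_lt_iff₀' hdn]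
  have hJc : IsPreconnected J := hJ' ▸ isPreconnected_Ioi
  have hnear : ∀ s ∈ J, (f d c)^[n] (γ s) ∈ nearInfinity c := fun s hs => by
    refine hR.trans_lt (lt_norm_of_lt_green hd hR ?_)
    rw [green_iterate hd, hγ.green_eq hd hs.1]; exact hs.2
  -- The continuation clause holds only from some index depending on `s`, so it gives just that `q
  -- s` is a root of unity of order dividing some `d ^ N`. These form a countable set, and `q = 1`
  -- far out.
  set q : ℝ → ℂ := fun s =>
    bottcher d c ((f d c)^[n] (γ s)) / radial ((d : ℝ) ^ n * s) (d ^ n • t) with hq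
  have hqc : ContinuousOn q J := by
    refine ContinuousOn.div ?_ ?_ fun s _ => radial_ne_zero _ _
    · exact (continuousOn_bottcher hd).comp ((continuous_iterate_f n).comp_continuousOn
        (hγ.continuousOn.mono inter_subset_left)) hnear
    · unfold radial; fun_prop
  have hC : (⋃ k : ℕ, {z : ℂ | z ^ d ^ k = 1}).Countable :=
    countable_iUnion fun k => (Complex.finite_setOf_pow_eq_one (by positivity)).countable
  have hqC : MapsTo q J (⋃ k : ℕ, {z : ℂ | z ^ d ^ k = 1}) := fun s hs => by
    obtain ⟨N, hN⟩ := eventually_atTop.1 (hγ.continuation s hs.1)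
    have h1 := (hN (N + n) (by omega)).2
    rw [Function.iterate_add_apply, bottcher_iterate hd (hnear s hs)] at h1
    refine mem_iUnion.2 ⟨N, ?_⟩
    rw [mem_ofPred_eq, hq, div_pow, h1, radial_pow, smul_smul, pow_add, pow_add, ← mul_assoc]
    push_cast
    exact div_self (radial_ne_zero _ _)
  obtain ⟨b, hb, hbJ⟩ := (hγ.near_infinity.and (hJ' ▸ eventually_gt_atTop _ :
    ∀ᶠ b in atTop, b ∈ J)).exists
  have h := hJc.eq_of_countable_image hqc hC hqC ⟨hs, hn⟩ hbJ
  have hb1 : q b = 1 := by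
    rw [hq]
    simp only
    rw [bottcher_iterate hd hb.1, hb.2, radial_pow]
    push_cast
    exact div_self (radial_ne_zero _ _)
  rw [hb1] at h
  exact (div_eq_one_iff_eq (radial_ne_zero _ _)).1 h

end IsRayAbove

/-- Two curves without precritical points that agree at one point and have the same image under
an iterate are equal. -/
theorem eqOn_of_iterate_eqOn (hd : 2 ≤ d) {I : Set ℝ} (hI : IsPreconnected I) {g₁ g₂ : ℝ → ℂ}
    (h₁ : ContinuousOn g₁ I) (h₂ : ContinuousOn g₂ I)
    (hne : ∀ s ∈ I, ∀ n : ℕ, (f d c)^[n] (g₂ s) ≠ 0) {a : ℝ} (ha : a ∈ I) (hga : g₁ a = g₂ a)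
    {n : ℕ} (hn : ∀ s ∈ I, (f d c)^[n] (g₁ s) = (f d c)^[n] (g₂ s)) : EqOn g₁ g₂ I := by
  induction n with
  | zero => exact hn
  | succ n ih =>
    refine ih fun s hs => ?_
    -- The quotient is a `d`-th root of unity, hence constant, and it is `1` at `a`; this undoes one
    -- application of `f_c`.
    set q : ℝ → ℂ := fun s => (f d c)^[n] (g₁ s) / (f d c)^[n] (g₂ s) with hq
    have hqc : ContinuousOn q I :=
      ((continuous_iterate_f n).comp_continuousOn h₁).div
        ((continuous_iterate_f n).comp_continuousOn h₂) fun s hs => hne s hs n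
    have hqC : MapsTo q I {z : ℂ | z ^ d = 1} := fun s hs => by
      have := hn s hs
      rw [Function.iterate_succ_apply', Function.iterate_succ_apply', f, f, add_left_inj] at this
      rw [mem_ofPred_eq, hq, div_pow, this]
      exact div_self (pow_ne_zero _ (hne s hs n))
    have h := hI.eq_of_countable_image hqc
      (Complex.finite_setOf_pow_eq_one (by omega)).countable hqC hs ha
    simp only [hq, hga, div_self (hne a ha n)] at h
    exact (div_eq_one_iff_eq (hne s hs n)).1 h

namespace IsRayAbove

variable {t t₁ t₂ : UnitAddCircle} {s₀ s₁ s₂ : ℝ} {γ γ₁ γ₂ : ℝ → ℂ}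

/-- Some iterate pushes all potentials above a chosen `b > 0` into the region where the Böttcher
coordinate is injective. The common point shows that the angles agree after multiplication by `d ^
n`, so the iterated rays coincide. Since the rays avoid precritical points, the equality pulls back.
-/
theorem eq_of_touch (h₁ : IsRayAbove d c t₁ s₁ γ₁) (h₂ : IsRayAbove d c t₂ s₂ γ₂) (hd : 2 ≤ d)
    (hs₁ : 0 ≤ s₁) {a : ℝ} (ha₁ : s₁ < a) (ha₂ : s₂ < a)
    (ha : γ₁ a = γ₂ a) {s : ℝ} (hs₁' : s₁ < s) (hs₂' : s₂ < s) : γ₁ s = γ₂ s := by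
  obtain ⟨R, hR, hinj⟩ := exists_injOn_bottcher (c := c) hd
  obtain ⟨b, hb, hbs⟩ := exists_between
    (max_lt (lt_min ha₁ hs₁') (lt_min ha₂ hs₂') : max s₁ s₂ < min a s)
  have hb₁ := (le_max_left _ _).trans_lt hb
  have hb₂ := (le_max_right _ _).trans_lt hb
  have hb0 : 0 < b := hs₁.trans_lt hb₁
  have hd' : (1 : ℝ) < d := by exact_mod_cast (by omega : 1 < d)
  obtain ⟨n, hn⟩ := (((tendsto_pow_atTop_atTop_of_one_lt hd').atTop_mul_const
    hb0).eventually_gt_atTop (Real.log R + 2 * greenBound d c)).exists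
  have hlt : ∀ x ∈ Ioi b, Real.log R + 2 * greenBound d c < d ^ n * x := fun x hx => by
    refine hn.trans ?_
    have : b < x := hx
    gcongr
  have hab : b < a := hbs.trans_le (min_le_left _ _)
  have ht : d ^ n • t₁ = d ^ n • t₂ := by
    have e₁ := h₁.bottcher_iterate_eq hd hR ha₁ (hlt a hab)
    rw [ha, h₂.bottcher_iterate_eq hd hR ha₂ (hlt a hab)] at e₁
    exact (radial_injective _ e₁).symm
  refine eqOn_of_iterate_eqOn hd (I := Ioi b) isPreconnected_Ioi
    (h₁.continuousOn.mono (Ioi_subset_Ioi hb₁.le)) (h₂.continuousOn.mono (Ioi_subset_Ioi hb₂.le))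
    (fun x hx => h₂.noncritical x (hb₂.trans hx)) (mem_Ioi.2 hab) ha (n := n) (fun x hx => ?_)
    (mem_Ioi.2 (hbs.trans_le (min_le_right _ _)))
  have e₁ := h₁.bottcher_iterate_eq hd hR (hb₁.trans hx) (hlt x hx)
  have e₂ := h₂.bottcher_iterate_eq hd hR (hb₂.trans hx) (hlt x hx)
  refine hinj (lt_norm_of_lt_green hd hR ?_) (lt_norm_of_lt_green hd hR ?_) (by rw [e₁, e₂, ht])
  · rw [green_iterate hd, h₁.green_eq hd (hb₁.trans hx)]; exact hlt x hx
  · rw [green_iterate hd, h₂.green_eq hd (hb₂.trans hx)]; exact hlt x hx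

/-- Rays at distinct angles are disjoint. -/
theorem angle_eq_of_touch (h₁ : IsRayAbove d c t₁ s₁ γ₁) (h₂ : IsRayAbove d c t₂ s₂ γ₂)
    (hd : 2 ≤ d) (hs₁ : 0 ≤ s₁) {a b : ℝ} (ha₁ : s₁ < a) (hb₂ : s₂ < b)
    (h : γ₁ a = γ₂ b) : t₁ = t₂ := by
  have hab : a = b := by rw [← h₁.green_eq hd ha₁, ← h₂.green_eq hd hb₂, h]
  subst hab
  obtain ⟨s, ⟨n₁, n₂⟩, m₁, m₂⟩ := ((h₁.near_infinity.and h₂.near_infinity).and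
    ((eventually_gt_atTop s₁).and (eventually_gt_atTop s₂))).exists
  refine radial_injective s ?_
  rw [← n₁.2, ← n₂.2, h₁.eq_of_touch h₂ hd hs₁ ha₁ hb₂ h m₁ m₂]

/-- The ray at a given angle is unique. -/
theorem unique (h₁ : IsRayAbove d c t s₁ γ₁) (h₂ : IsRayAbove d c t s₂ γ₂) (hd : 2 ≤ d)
    (hs₁ : 0 ≤ s₁) {s : ℝ} (hs₁' : s₁ < s) (hs₂' : s₂ < s) : γ₁ s = γ₂ s := by
  obtain ⟨R, hR, hinj⟩ := exists_injOn_bottcher (c := c) hd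
  obtain ⟨a, ⟨⟨n₁, n₂⟩, r₁, r₂⟩, m₁, m₂⟩ := (((h₁.near_infinity.and h₂.near_infinity).and
    ((h₁.eventually_lt_norm hd R).and (h₂.eventually_lt_norm hd R))).and
    ((eventually_gt_atTop s₁).and (eventually_gt_atTop s₂))).exists
  exact h₁.eq_of_touch h₂ hd hs₁ m₁ m₂ (hinj r₁ r₂ (by rw [n₁.2, n₂.2])) hs₁' hs₂'

theorem image_eq_dynamicalRay (hγ : IsRayAbove d c t 0 γ) (hd : 2 ≤ d) :
    dynamicalRay d c t = γ '' Ioi 0 := by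
  ext w
  constructor
  · rintro ⟨s₀, γ', h0, hγ', s, hs, rfl⟩
    exact ⟨s, h0.trans_lt hs, hγ.unique hγ' hd le_rfl (h0.trans_lt hs) hs⟩
  · rintro ⟨s, hs, rfl⟩
    exact ⟨0, γ, le_rfl, hγ, s, hs, rfl⟩

/-- A ray that is defined for all potentials and converges lands at its limit. -/
theorem rayLandsAt (hγ : IsRayAbove d c t 0 γ) (hd : 2 ≤ d) {z : ℂ} (hz : z ∈ filledJulia d c)
    (hlim : Tendsto γ (𝓝[>] 0) (𝓝 z)) : RayLandsAt d c t z := by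
  rw [RayLandsAt, hγ.image_eq_dynamicalRay hd]
  refine Subset.antisymm (fun w hw => ?_) ?_
  · by_contra hne
    obtain ⟨U, V, hU, hV, hwU, hzV, hUV⟩ := t2_separation hne
    obtain ⟨δ, hδ, hδV⟩ := mem_nhdsGT_iff_exists_Ioo_subset.1 (hlim (hV.mem_nhds hzV))
    -- A ray point close to a point of the filled-in Julia set has small Green value, that is, a
    -- small parameter, and is then close to the limit `z`.
    have hopen : IsOpen (U ∩ {v | green d c v < δ}) :=
      hU.inter (isOpen_lt (continuous_green hd) continuous_const)
    obtain ⟨_, ⟨hv, hvδ⟩, s, hs, rfl⟩ := mem_closure_iff.1 hw.1 _ hopen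
      ⟨hwU, by rw [mem_ofPred_eq, green_eq_zero hd hw.2]; exact hδ⟩
    rw [mem_ofPred_eq, hγ.green_eq hd hs] at hvδ
    exact hUV.le_bot ⟨hv, hδV ⟨hs, hvδ⟩⟩
  · rintro _ rfl
    exact ⟨mem_closure_of_tendsto hlim
      (eventually_mem_nhdsWithin.mono fun s hs => mem_image_of_mem γ hs), hz⟩

end IsRayAbove

theorem RayLandsAt.mem_filledJulia {t : UnitAddCircle} {z : ℂ} (h : RayLandsAt d c t z) :
    z ∈ filledJulia d c := (h.symm.subset (mem_singleton z)).2

theorem RayLandsAt.unique {t : UnitAddCircle} {z w : ℂ} (h : RayLandsAt d c t z)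
    (h' : RayLandsAt d c t w) : z = w := singleton_injective (h.symm.trans h')

/-- A ray that lands is defined for all positive potentials and converges to its landing point. -/
theorem RayLandsAt.exists_ray {t : UnitAddCircle} {z : ℂ} (hd : 2 ≤ d) (h : RayLandsAt d c t z) :
    ∃ γ, IsRayAbove d c t 0 γ ∧ Tendsto γ (𝓝[>] 0) (𝓝 z) := by
  have hzK := h.mem_filledJulia
  have hzc : z ∈ closure (dynamicalRay d c t) := (h.symm.subset (mem_singleton z)).1
  have hex : ∀ ε : ℝ, ∃ (s₀ : ℝ) (γ : ℝ → ℂ), 0 < ε → 0 ≤ s₀ ∧ s₀ < ε ∧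
      IsRayAbove d c t s₀ γ := fun ε => by
    by_cases hε : 0 < ε
    · obtain ⟨_, hw, s₀, γ, h0, hγ, s, hs, rfl⟩ := mem_closure_iff.1 hzc
        {v | green d c v < ε} (isOpen_lt (continuous_green hd) continuous_const)
        (by rw [mem_ofPred_eq, green_eq_zero hd hzK]; exact hε)
      rw [mem_ofPred_eq, hγ.green_eq hd hs] at hw
      exact ⟨s₀, γ, fun _ => ⟨h0, hs.trans hw, hγ⟩⟩
    · exact ⟨0, 0, fun h => absurd h hε⟩
  choose S Γ hSΓ using hex
  -- The partial ray chosen for `s` is already defined at `s`; uniqueness of rays glues these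
  -- choices to one ray on all positive potentials.
  set γ : ℝ → ℂ := fun s => Γ s s with hγdef
  have hagree : ∀ ε, 0 < ε → ∀ s, S ε < s → γ s = Γ ε s := fun ε hε s hs => by
    obtain ⟨h0, -, hr⟩ := hSΓ ε hε
    obtain ⟨h0', hs', hr'⟩ := hSΓ s (h0.trans_lt hs)
    exact hr'.unique hr hd h0' hs' hs
  have hray : IsRayAbove d c t 0 γ := by
    refine ⟨fun s hs => ?_, ?_, fun s hs => ?_, fun s hs => ?_⟩
    · obtain ⟨h0, hlt, hr⟩ := hSΓ s hs
      have h1 : ContinuousAt (Γ s) s := hr.continuousOn.continuousAt (Ioi_mem_nhds hlt)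
      refine (h1.congr ?_).continuousWithinAt
      filter_upwards [Ioi_mem_nhds hlt] with x hx
      exact (hagree s hs x hx).symm
    · obtain ⟨h0, hlt, hr⟩ := hSΓ 1 one_pos
      filter_upwards [hr.near_infinity, eventually_gt_atTop (S 1)] with x hx hx'
      rwa [hagree 1 one_pos x hx']
    · exact (hSΓ s hs).2.2.noncritical s (hSΓ s hs).2.1
    · exact (hSΓ s hs).2.2.continuation s (hSΓ s hs).2.1
  refine ⟨γ, hray, ?_⟩
  -- The ray is bounded for potentials below `1`, and each cluster point at potential `0` has Green
  -- value `0` and lies in the closure of the ray, so it is `z`.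
  refine (isCompact_closedBall (0 : ℂ)
    (Real.exp (1 + 2 * greenBound d c))).tendsto_nhds_of_unique_mapClusterPt ?_ fun y _ hy => ?_
  · filter_upwards [Ioo_mem_nhdsGT one_pos] with s hs
    rw [mem_closedBall_zero_iff]
    exact norm_le_of_green_le hd (by rw [hray.green_eq hd hs.1]; exact hs.2.le)
  · have hy1 : MapClusterPt (green d c y) (𝓝[>] (0 : ℝ)) (green d c ∘ γ) :=
      hy.continuousAt_comp (continuous_green hd).continuousAt
    have hy2 : Tendsto (green d c ∘ γ) (𝓝[>] (0 : ℝ)) (𝓝 0) := by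
      refine (tendsto_nhdsWithin_of_tendsto_nhds tendsto_id).congr' ?_
      filter_upwards [self_mem_nhdsWithin] with s hs
      exact (hray.green_eq hd hs).symm
    have hy0 : green d c y = 0 := by
      by_contra hne
      obtain ⟨U, V, hU, hV, hwU, hzV, hUV⟩ := t2_separation hne
      obtain ⟨s, hs, hs'⟩ := ((hy1.frequently (hU.mem_nhds hwU)).and_eventually
        (hy2.eventually (hV.mem_nhds hzV))).exists
      exact hUV.le_bot ⟨hs, hs'⟩
    have hyc : y ∈ closure (dynamicalRay d c t) := by
      rw [hray.image_eq_dynamicalRay hd, mem_closure_iff_nhds]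
      intro U hU
      obtain ⟨s, hs, hs'⟩ := ((hy.frequently hU).and_eventually self_mem_nhdsWithin).exists
      exact ⟨γ s, hs, mem_image_of_mem γ hs'⟩
    exact h.subset ⟨hyc, mem_filledJulia_of_green_eq_zero hd hy0⟩

end Rays

/-! ### Landing rays: dynamics, symmetry and the noncrossing property -/

section Landing

variable {d : ℕ} {c : ℂ}

theorem f_mem_filledJulia {z : ℂ} (hz : z ∈ filledJulia d c) : f d c z ∈ filledJulia d c := by
  refine Bornology.IsBounded.subset (t := range fun n : ℕ => (f d c)^[n] z) hz ?_
  rintro _ ⟨n, rfl⟩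
  exact ⟨n + 1, Function.iterate_succ_apply _ _ _⟩

/-- The image of a landing ray lands at the image of the landing point. -/
theorem RayLandsAt.map {t : UnitAddCircle} {z : ℂ} (hd : 2 ≤ d) (h : RayLandsAt d c t z) :
    RayLandsAt d c (d • t) (f d c z) := by
  obtain ⟨γ, hγ, hlim⟩ := h.exists_ray hd
  have hd0 : (0 : ℝ) < d := by exact_mod_cast (by omega : 0 < d)
  have hdiv : Tendsto (fun s : ℝ => s / d) (𝓝[>] 0) (𝓝[>] 0) := by
    refine tendsto_nhdsWithin_iff.2 ⟨?_, ?_⟩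
    · have : Tendsto (fun s : ℝ => s / d) (𝓝 0) (𝓝 (0 / d)) := tendsto_id.div_const _
      rw [zero_div] at this
      exact tendsto_nhdsWithin_of_tendsto_nhds this
    · exact eventually_mem_nhdsWithin.mono fun s hs => div_pos hs hd0
  refine IsRayAbove.rayLandsAt (γ := fun s => f d c (γ (s / d))) ?_ hd
    (f_mem_filledJulia h.mem_filledJulia)
    ((continuous_f.tendsto z).comp (hlim.comp hdiv))
  refine ⟨?_, ?_, fun s hs n => ?_, fun s hs => ?_⟩
  · exact continuous_f.comp_continuousOn
      (hγ.continuousOn.comp (by fun_prop) fun s hs => div_pos hs hd0)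
  · filter_upwards [(tendsto_id.atTop_div_const hd0).eventually hγ.near_infinity] with s hs
    simp only [id_eq] at hs
    refine ⟨iterate_mem_nearInfinity hd hs.1 1, ?_⟩
    rw [bottcher_f hd hs.1, hs.2, radial_pow]
    congr 1
    field_simp
  · exact hγ.noncritical (s / d) (div_pos hs hd0) (n + 1)
  · filter_upwards [(tendsto_add_atTop_nat 1).eventually
      (hγ.continuation (s / d) (div_pos hs hd0))] with n hn
    rw [Function.iterate_succ_apply] at hn
    refine ⟨hn.1, hn.2.trans ?_⟩
    rw [smul_smul, ← pow_succ]
    congr 1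
    rw [pow_succ]
    field_simp

theorem RayLandsAt.iterate {t : UnitAddCircle} {z : ℂ} (hd : 2 ≤ d) (h : RayLandsAt d c t z)
    (n : ℕ) : RayLandsAt d c (d ^ n • t) ((f d c)^[n] z) := by
  induction n with
  | zero => simpa using h
  | succ n ih =>
    have := ih.map hd
    rwa [smul_smul, ← pow_succ', ← Function.iterate_succ_apply' (f d c)] at this

/-- The primitive root of unity `exp (2πi/d)`. -/
def rotation (d : ℕ) : ℂ := unit (1 / d)

theorem isPrimitiveRoot_rotation (hd : 2 ≤ d) : IsPrimitiveRoot (rotation d) d := by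
  convert! Complex.isPrimitiveRoot_exp d (by omega) using 1
  rw [rotation, unit]
  congr 1
  push_cast
  ring

theorem rotation_pow (hd : 2 ≤ d) : rotation d ^ d = 1 := (isPrimitiveRoot_rotation hd).pow_eq_one

theorem norm_rotation_mul (z : ℂ) : ‖rotation d * z‖ = ‖z‖ := by
  rw [norm_mul, rotation, norm_unit, one_mul]

theorem f_rotation_mul (hd : 2 ≤ d) (z : ℂ) : f d c (rotation d * z) = f d c z := by
  rw [f, f, mul_pow, rotation_pow hd, one_mul]

theorem iterate_rotation_mul (hd : 2 ≤ d) (z : ℂ) {n : ℕ} (hn : 1 ≤ n) :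
    (f d c)^[n] (rotation d * z) = (f d c)^[n] z := by
  obtain ⟨m, rfl⟩ := Nat.exists_eq_add_of_le' hn
  rw [Function.iterate_succ_apply, f_rotation_mul hd, ← Function.iterate_succ_apply]

theorem bottcher_rotation_mul (hd : 2 ≤ d) (z : ℂ) :
    bottcher d c (rotation d * z) = rotation d * bottcher d c z := by
  have : ∀ n, ((f d c)^[n] (rotation d * z)) ^ d = ((f d c)^[n] z) ^ d := fun n => by
    rcases Nat.eq_zero_or_pos n with rfl | hn
    · simp [mul_pow, rotation_pow hd]
    · rw [iterate_rotation_mul hd z hn]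
  simp only [bottcher, this, mul_assoc]

/-- The rotation changes only the zeroth point of an orbit, and it commutes with the Böttcher
coordinate. This symmetry is the source of every `1 / d` below. -/
theorem RayLandsAt.rotate {t : UnitAddCircle} {z : ℂ} (hd : 2 ≤ d) (h : RayLandsAt d c t z) :
    RayLandsAt d c (t + ((1 / d : ℝ) : UnitAddCircle)) (rotation d * z) := by
  obtain ⟨γ, hγ, hlim⟩ := h.exists_ray hd
  have hd0 : (d : ℝ) ≠ 0 := by exact_mod_cast (by omega : d ≠ 0)
  have hK : rotation d * z ∈ filledJulia d c := by
    refine Bornology.IsBounded.subset (t := insert (rotation d * z)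
      (range fun n : ℕ => (f d c)^[n] z)) ?_ ?_
    · exact Bornology.isBounded_insert.2 h.mem_filledJulia
    · rintro _ ⟨n, rfl⟩
      rcases Nat.eq_zero_or_pos n with rfl | hn
      · exact Or.inl rfl
      · exact Or.inr ⟨n, (iterate_rotation_mul hd z hn).symm⟩
  refine IsRayAbove.rayLandsAt (γ := fun s => rotation d * γ s) ?_ hd hK (hlim.const_mul _)
  refine ⟨hγ.continuousOn.const_mul _, ?_, fun s hs n => ?_, fun s hs => ?_⟩
  · filter_upwards [hγ.near_infinity] with s hs
    refine ⟨?_, ?_⟩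
    · change 1 + ‖c‖ < ‖rotation d * γ s‖
      rw [norm_rotation_mul]; exact hs.1
    · rw [bottcher_rotation_mul hd, hs.2, radial_add_coe, rotation]
  · rcases Nat.eq_zero_or_pos n with rfl | hn
    · exact mul_ne_zero (unit_ne_zero _) (hγ.noncritical s hs 0)
    · rw [iterate_rotation_mul hd _ hn]; exact hγ.noncritical s hs n
  · filter_upwards [hγ.continuation s hs, eventually_ge_atTop 1] with n hn hn1
    have : d ^ n • (t + ((1 / d : ℝ) : UnitAddCircle)) = d ^ n • t := by
      obtain ⟨m, rfl⟩ := Nat.exists_eq_add_of_le' hn1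
      rw [smul_add, ← AddCircle.coe_nsmul, add_eq_left]
      refine (AddCircle.coe_eq_zero_iff _).2 ⟨(d : ℤ) ^ m, ?_⟩
      rw [zsmul_eq_mul, nsmul_eq_mul]
      push_cast
      field_simp
      ring
    rw [iterate_rotation_mul hd _ hn1, this]
    exact hn

theorem RayLandsAt.rotate_iterate {t : UnitAddCircle} {z : ℂ} (hd : 2 ≤ d)
    (h : RayLandsAt d c t z) (j : ℕ) :
    RayLandsAt d c (t + ((j / d : ℝ) : UnitAddCircle)) (rotation d ^ j * z) := by
  induction j with
  | zero => simpa using h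
  | succ j ih =>
    have := ih.rotate hd
    rw [add_assoc, ← AddCircle.coe_add, ← mul_assoc, ← pow_succ', ← add_div] at this
    exact_mod_cast this

/-- A ray never lands at a superattracting periodic point. -/
theorem RayLandsAt.ne_zero {t : UnitAddCircle} {z : ℂ} (hd : 2 ≤ d) (h : RayLandsAt d c t z)
    {p : ℕ} (hp : 0 < p) (hz : (f d c)^[p] z = z) : z ≠ 0 := by
  rintro rfl
  obtain ⟨γ, hγ, hlim⟩ := h.exists_ray hd
  obtain ⟨m, rfl⟩ := Nat.exists_eq_add_of_le' hp
  have hf : HasDerivAt (f d c) 0 0 := by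
    have := (hasDerivAt_pow d (0 : ℂ)).add_const c
    rwa [zero_pow (by omega), mul_zero] at this
  have hF : HasDerivAt ((f d c)^[m + 1]) 0 0 := by
    have := (differentiable_iterate_f (d := d) (c := c) m (f d c 0)).hasDerivAt.comp 0 hf
    rwa [mul_zero, ← Function.iterate_succ] at this
  -- The critical point lies on the cycle, so the return map has derivative `0` and does not
  -- increase the norm near `0`. Nearby orbits of the return map stay bounded, so `green` vanishes
  -- near `0`; but on the ray it equals the positive potential.
  have hsmall := hF.isLittleO.def one_pos
  obtain ⟨δ, hδ, hδF⟩ := Metric.eventually_nhds_iff.1 hsmall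
  simp only [hz, sub_zero, smul_zero, one_mul, dist_zero_right] at hδF
  have horbit : ∀ v : ℂ, ‖v‖ < δ → ∀ k : ℕ, ‖(f d c)^[(m + 1) * k] v‖ ≤ ‖v‖ := fun v hv k => by
    induction k with
    | zero => simp
    | succ k ih =>
      rw [Nat.mul_succ, Nat.add_comm, Function.iterate_add_apply]
      exact (hδF (ih.trans_lt hv)).trans ih
  obtain ⟨B, hB⟩ := (isCompact_closedBall (0 : ℂ) δ).exists_bound_of_continuousOn
    (continuous_green (d := d) (c := c) hd).continuousOn
  have hgreen : ∀ v : ℂ, ‖v‖ < δ → green d c v = 0 := fun v hv => by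
    refine eq_zero_of_abs_pow_mul_le (d := d ^ (m + 1))
      (hd.trans (le_self_pow₀ (by omega) (by omega))) (B := B) (.of_forall fun k => ?_)
    push_cast
    rw [← pow_mul, ← green_iterate hd v]
    exact hB _ (by simpa using (horbit v hv k).trans hv.le)
  obtain ⟨s, hs, hs0⟩ := ((hlim.eventually (Metric.ball_mem_nhds 0 hδ)).and
    self_mem_nhdsWithin).exists
  have h1 := hgreen (γ s) (by simpa using hs)
  rw [hγ.green_eq hd hs0] at h1
  exact (ne_of_gt hs0) h1

/-- A ray together with its landing point, as a curve on the whole line that rests at the landing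
point for negative times. -/
theorem exists_curve {t : UnitAddCircle} {z : ℂ} (hd : 2 ≤ d) (h : RayLandsAt d c t z) :
    ∃ (γ e : ℝ → ℂ), IsRayAbove d c t 0 γ ∧ Continuous e ∧ (∀ x, 0 < x → e x = γ x) ∧
      ∀ x, x ≤ 0 → e x = z := by
  obtain ⟨γ, hγ, hlim⟩ := h.exists_ray hd
  refine ⟨γ, fun x => if 0 < x then γ x else z, hγ, ?_, fun x hx => if_pos hx,
    fun x hx => if_neg (not_lt.2 hx)⟩
  rw [continuous_iff_continuousAt]
  intro x
  rcases lt_trichotomy x 0 with hx | rfl | hx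
  · refine continuousAt_const.congr (f := fun _ => z) ?_
    filter_upwards [Iio_mem_nhds hx] with y hy
    exact (if_neg (not_lt.2 (le_of_lt hy))).symm
  · rw [← continuousWithinAt_univ, ← Iic_union_Ioi (a := (0 : ℝ)), continuousWithinAt_union]
    constructor
    · refine continuousWithinAt_const.congr (f := fun _ => z) (fun y hy => if_neg (not_lt.2 hy))
        (if_neg (lt_irrefl _))
    · rw [ContinuousWithinAt, if_neg (lt_irrefl _)]
      exact hlim.congr' (eventually_mem_nhdsWithin.mono fun y hy => (if_pos hy).symm)
  · refine (hγ.continuousOn.continuousAt (Ioi_mem_nhds hx)).congr ?_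
    filter_upwards [Ioi_mem_nhds hx] with y hy
    exact (if_pos hy).symm

/-- Two rays that land at the same point, joined to a curve. -/
theorem exists_joined_curve {α₁ α₂ : ℝ} {z : ℂ} (hd : 2 ≤ d)
    (h₁ : RayLandsAt d c (α₁ : UnitAddCircle) z) (h₂ : RayLandsAt d c (α₂ : UnitAddCircle) z) :
    ∃ Γ : ℝ → ℂ, Continuous Γ ∧
      Tendsto (fun y => Γ y / (Real.exp y : ℝ)) atTop (𝓝 (unit α₁)) ∧
      Tendsto (fun y => Γ (-y) / (Real.exp y : ℝ)) atTop (𝓝 (unit α₂)) ∧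
      ∀ x, Γ x = z ∨ ∃ α ∈ ({α₁, α₂} : Set ℝ), ∃ (γ : ℝ → ℂ) (a : ℝ),
        IsRayAbove d c (α : UnitAddCircle) 0 γ ∧ 0 < a ∧ Γ x = γ a := by
  obtain ⟨γ₁, e₁, hγ₁, he₁, hp₁, hn₁⟩ := exists_curve hd h₁
  obtain ⟨γ₂, e₂, hγ₂, he₂, hp₂, hn₂⟩ := exists_curve hd h₂
  refine ⟨fun x => if 0 ≤ x then e₁ x else e₂ (-x), ?_, ?_, ?_, fun x => ?_⟩
  · refine Continuous.if_le he₁ (he₂.comp continuous_neg) continuous_const continuous_id ?_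
    rintro x rfl
    rw [hn₁ 0 le_rfl]
    exact (hn₂ _ (by simp)).symm
  · rw [← toCircle_coe_eq_unit]
    refine (hγ₁.tendsto_div_exp hd).congr' ?_
    filter_upwards [eventually_gt_atTop 0] with x hx
    rw [if_pos hx.le, hp₁ x hx]
  · rw [← toCircle_coe_eq_unit]
    refine (hγ₂.tendsto_div_exp hd).congr' ?_
    filter_upwards [eventually_gt_atTop 0] with x hx
    rw [if_neg (by linarith), neg_neg, hp₂ x hx]
  · rcases lt_trichotomy x 0 with hx | rfl | hx
    · refine Or.inr ⟨α₂, by simp, γ₂, -x, hγ₂, by linarith,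
        (if_neg (not_le.2 hx)).trans (hp₂ _ (by linarith))⟩
    · exact Or.inl ((if_pos le_rfl).trans (hn₁ 0 le_rfl))
    · refine Or.inr ⟨α₁, by simp, γ₁, x, hγ₁, hx, (if_pos hx.le).trans (hp₁ x hx)⟩

/-- Rays landing at two distinct points are not linked. -/
theorem not_linked {α₁ α₂ β₁ β₂ : ℝ} {z w : ℂ} (hd : 2 ≤ d) (hzw : z ≠ w)
    (hα₁ : RayLandsAt d c (α₁ : UnitAddCircle) z) (hα₂ : RayLandsAt d c (α₂ : UnitAddCircle) z)
    (hβ₁ : RayLandsAt d c (β₁ : UnitAddCircle) w) (hβ₂ : RayLandsAt d c (β₂ : UnitAddCircle) w)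
    (h12 : α₁ < β₁) (h23 : β₁ < α₂) (h34 : α₂ < β₂) (h41 : β₂ < α₁ + 1) : False := by
  obtain ⟨Γ₁, c₁, a₁, a₂, p₁⟩ := exists_joined_curve hd hα₁ hα₂
  obtain ⟨Γ₂, c₂, b₁, b₂, p₂⟩ := exists_joined_curve hd hβ₁ hβ₂
  obtain ⟨x, y, hxy⟩ := exists_intersection_of_linked c₁ c₂ a₁ a₂ b₁ b₂ h12 h23 h34 h41
  have hz := green_eq_zero hd hα₁.mem_filledJulia
  have hw := green_eq_zero hd hβ₁.mem_filledJulia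
  -- The Green value separates landing points from ray points. A common point of two rays forces
  -- equal angles, hence equal landing points.
  rcases p₁ x with h | ⟨α, hα, γ, a, hγ, ha, h⟩ <;>
    rcases p₂ y with h' | ⟨β, hβ, γ', b, hγ', hb, h'⟩
  · exact hzw (h.symm.trans (hxy.trans h'))
  · have := hγ'.green_eq hd hb
    rw [← h', ← hxy, h, hz] at this
    exact hb.ne this
  · have := hγ.green_eq hd ha
    rw [← h, hxy, h', hw] at this
    exact ha.ne this
  · have := hγ.angle_eq_of_touch hγ' hd le_rfl ha hb (h.symm.trans (hxy.trans h'))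
    refine hzw ?_
    have e1 : RayLandsAt d c (α : UnitAddCircle) z := by
      rcases hα with rfl | rfl <;> assumption
    have e2 : RayLandsAt d c (β : UnitAddCircle) w := by
      rcases hβ with rfl | rfl <;> assumption
    exact e1.unique (this ▸ e2)

end Landing

/-! ### Circle combinatorics -/

section Circle

theorem coe_circle_eq_coe_iff {x y : ℝ} :
    (x : UnitAddCircle) = (y : UnitAddCircle) ↔ ∃ k : ℤ, x = y + k := by
  rw [← sub_eq_zero, ← AddCircle.coe_sub, AddCircle.coe_eq_zero_iff]
  simp only [zsmul_eq_mul, mul_one]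
  exact ⟨fun ⟨k, hk⟩ => ⟨k, by linarith⟩, fun ⟨k, hk⟩ => ⟨k, by linarith⟩⟩

theorem exists_coe_eq_mem_Ico (a : ℝ) (θ : UnitAddCircle) :
    ∃ x ∈ Ico a (a + 1), (x : UnitAddCircle) = θ := by
  have : θ ∈ (QuotientAddGroup.mk '' Ico a (a + 1) : Set UnitAddCircle) := by
    rw [AddCircle.coe_image_Ico_eq]; trivial
  exact this

theorem eq_of_coe_circle_eq {x y : ℝ} (h : (x : UnitAddCircle) = (y : UnitAddCircle))
    (hxy : |x - y| < 1) : x = y := by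
  obtain ⟨k, rfl⟩ := coe_circle_eq_coe_iff.1 h
  rw [add_sub_cancel_left] at hxy
  have : k = 0 := Int.abs_lt_one_iff.1 (by exact_mod_cast hxy)
  simp [this]

/-- The cyclic order of three points of the circle with lifts in an interval of length less than
`1`. -/
theorem sbtw_coe_iff {x y z : ℝ} (hxy : |x - y| < 1) (hyz : |y - z| < 1) (hxz : |x - z| < 1) :
    sbtw (x : UnitAddCircle) (y : UnitAddCircle) (z : UnitAddCircle) ↔
      (x < y ∧ y < z) ∨ (y < z ∧ z < x) ∨ (z < x ∧ x < y) := by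
  rw [sbtw_iff_not_btw, QuotientAddGroup.btw_coe_iff, not_le]
  rw [abs_lt] at *
  have h1 : toIcoMod (zero_lt_one : (0 : ℝ) < 1) z y = if z ≤ y then y else y + 1 := by
    rw [toIcoMod_eq_iff]
    split_ifs with h
    · exact ⟨⟨h, by linarith⟩, 0, by simp⟩
    · exact ⟨⟨by linarith, by linarith⟩, -1, by simp⟩
  have h2 : toIocMod (zero_lt_one : (0 : ℝ) < 1) z x = if z < x then x else x + 1 := by
    rw [toIocMod_eq_iff]
    split_ifs with h
    · exact ⟨⟨h, by linarith⟩, 0, by simp⟩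
    · exact ⟨⟨by linarith, by linarith⟩, -1, by simp⟩
  rw [h1, h2]
  split_ifs <;> constructor <;> intro h
  all_goals grind

theorem sbtw_coe_base_iff {a x y : ℝ} (hx : x ∈ Ioo 0 1) (hy : y ∈ Ioo 0 1) :
    sbtw (a : UnitAddCircle) ((a + x : ℝ) : UnitAddCircle) ((a + y : ℝ) : UnitAddCircle) ↔
      x < y := by
  rw [mem_Ioo] at hx hy
  rw [sbtw_coe_iff] <;> grind

/-- A convergent sequence whose increments are multiplied by `N` modulo `1` is stationary. -/
theorem exists_eq_succ_of_expanding {v : ℕ → ℝ} {L : ℝ} (hv : Tendsto v atTop (𝓝 L)) {N : ℕ}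
    (hN : 1 ≤ N) (h : ∀ n, ∃ k : ℤ, v (n + 2) - v (n + 1) = N * (v (n + 1) - v n) + k) :
    ∃ n, v (n + 1) = v n := by
  by_contra! hne
  have hg : Tendsto (fun n => |v (n + 1) - v n|) atTop (𝓝 0) := by
    have := ((hv.comp (tendsto_add_atTop_nat 1)).sub hv).abs
    simpa using this
  have hN0 : (1 : ℝ) ≤ N := by exact_mod_cast hN
  -- Below `1 / (2 * N)` both the next increment and `N` times the current one are less than `1 /
  -- 2`, so the integer `k` is `0`. The increments then do not shrink, although they tend to `0`.
  obtain ⟨m, hm⟩ := eventually_atTop.1 (hg.eventually_lt_const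
    (show (0 : ℝ) < 1 / (2 * N) by positivity))
  have hstep : ∀ n, m ≤ n → |v (n + 1) - v n| ≤ |v (n + 1 + 1) - v (n + 1)| := fun n hn => by
    obtain ⟨k, hk⟩ := h n
    have h1 := hm n hn
    have h2 := hm (n + 1) (by omega)
    have h1' : |N * (v (n + 1) - v n)| < 1 / 2 := by
      rw [abs_mul, abs_of_pos (by linarith : (0 : ℝ) < N)]
      rw [lt_div_iff₀ (by positivity)] at h1
      linarith
    have h2' : |v (n + 1 + 1) - v (n + 1)| < 1 / 2 := h2.trans_le (by
      rw [div_le_div_iff₀ (by positivity) (by positivity)]; linarith)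
    have hk0 : k = 0 := by
      refine Int.abs_lt_one_iff.1 ?_
      have : |(k : ℝ)| < 1 := by
        have e : (k : ℝ) = (v (n + 1 + 1) - v (n + 1)) - N * (v (n + 1) - v n) := by
          linarith [hk]
        rw [e]
        rw [abs_lt] at *
        constructor <;> linarith [h1'.1, h1'.2, h2'.1, h2'.2]
      exact_mod_cast this
    rw [show v (n + 1 + 1) - v (n + 1) = N * (v (n + 1) - v n) by
      rw [show n + 1 + 1 = n + 2 from rfl, hk, hk0]; simp, abs_mul,
      abs_of_pos (by linarith : (0 : ℝ) < N)]
    nlinarith [abs_nonneg (v (n + 1) - v n)]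
  have hge : ∀ n, |v (m + 1) - v m| ≤ |v (m + n + 1) - v (m + n)| := fun n => by
    induction n with
    | zero => exact le_rfl
    | succ n ih => exact ih.trans (hstep (m + n) (by omega))
  have hpos : 0 < |v (m + 1) - v m| := abs_pos.2 (sub_ne_zero.2 (hne m))
  obtain ⟨n, hn⟩ := eventually_atTop.1 (hg.eventually_lt_const hpos)
  have h1 := hn (m + n) (by omega)
  exact absurd (hge n) (not_le.2 h1)

/-- If multiplication by `N ≥ 2` maps a set of angles to itself injectively, preserving the cyclic
order, and fixes one of the angles, then it fixes all of them. -/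
theorem smul_eq_of_sbtw_preserving {A : Set UnitAddCircle} {N : ℕ} (hN : 1 ≤ N)
    (hmaps : MapsTo (fun θ => N • θ) A A) (hinj : InjOn (fun θ => N • θ) A)
    (hsbtw : ∀ θ₁ ∈ A, ∀ θ₂ ∈ A, ∀ θ₃ ∈ A, sbtw θ₁ θ₂ θ₃ → sbtw (N • θ₁) (N • θ₂) (N • θ₃))
    {θ : UnitAddCircle} (hθ : θ ∈ A) (hfix : N • θ = θ) {x : UnitAddCircle} (hx : x ∈ A) :
    N • x = x := by
  by_contra hne
  set X : ℕ → UnitAddCircle := fun n => N ^ n • x with hX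
  have hsucc : ∀ n, X (n + 1) = N • X n := fun n => by
    simp only [hX]; rw [smul_smul, pow_succ']
  have hXA : ∀ n, X n ∈ A := fun n => by
    induction n with
    | zero => simpa [hX] using hx
    | succ n ih => rw [hsucc]; exact hmaps ih
  have hXθ : ∀ n, X n ≠ θ := fun n => by
    induction n with
    | zero => intro h; apply hne; simp only [hX, pow_zero, one_smul] at h; rw [h, hfix]
    | succ n ih => intro h; rw [hsucc] at h; exact ih (hinj (hXA n) hθ (h.trans hfix.symm))
  have hXX : ∀ n, X (n + 1) ≠ X n := fun n => by
    induction n with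
    | zero => simpa [hX] using hne
    | succ n ih =>
      intro h
      rw [hsucc (n + 1), hsucc n] at h
      exact ih (hinj (hXA _) (hXA _) ((hsucc n ▸ h : N • X (n + 1) = N • X n)))
  -- Cutting the circle at the fixed angle `θ` turns the cyclic order into the order of the lifts `v
  -- n` in `(0, 1)`. By injectivity the orbit never reaches `θ` and never becomes stationary.
  obtain ⟨a, -, ha⟩ := exists_coe_eq_mem_Ico 0 θ
  choose w hw hwX using fun n => exists_coe_eq_mem_Ico a (X n)
  set v : ℕ → ℝ := fun n => w n - a with hv
  have hwv : ∀ n, ((a + v n : ℝ) : UnitAddCircle) = X n := fun n => by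
    rw [hv, add_sub_cancel]; exact hwX n
  have hvI : ∀ n, v n ∈ Ioo (0 : ℝ) 1 := fun n => by
    refine ⟨lt_of_le_of_ne (by linarith [(hw n).1]) fun h => ?_, by
      simp only [hv]; linarith [(hw n).2]⟩
    apply hXθ n
    rw [← hwv n, ← h, add_zero, ha]
  have hvne : ∀ n, v (n + 1) ≠ v n := fun n h => hXX n (by rw [← hwv, ← hwv, h])
  have hlt_iff : ∀ m n, sbtw θ (X m) (X n) ↔ v m < v n := fun m n => by
    rw [← hwv, ← hwv, ← ha]
    exact sbtw_coe_base_iff (hvI m) (hvI n)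
  have hlt_succ : ∀ m n, v m < v n → v (m + 1) < v (n + 1) := fun m n h => by
    have := hsbtw θ hθ _ (hXA m) _ (hXA n) ((hlt_iff m n).2 h)
    rwa [hfix, ← hsucc, ← hsucc, hlt_iff] at this
  have hconv : ∃ L, Tendsto v atTop (𝓝 L) := by
    rcases lt_or_gt_of_ne (hvne 0) with h | h
    · have hanti : Antitone v := antitone_nat_of_succ_le fun n => by
        have : v (n + 1) < v n := by
          induction n with
          | zero => exact h
          | succ n ih => exact hlt_succ _ _ ih
        exact this.le
      exact ⟨_, tendsto_atTop_ciInf hanti ⟨0, by rintro _ ⟨n, rfl⟩; exact (hvI n).1.le⟩⟩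
    · have hmono : Monotone v := monotone_nat_of_le_succ fun n => by
        have : v n < v (n + 1) := by
          induction n with
          | zero => exact h
          | succ n ih => exact hlt_succ _ _ ih
        exact this.le
      exact ⟨_, tendsto_atTop_ciSup hmono ⟨1, by rintro _ ⟨n, rfl⟩; exact (hvI n).2.le⟩⟩
  obtain ⟨L, hL⟩ := hconv
  obtain ⟨n, hn⟩ := exists_eq_succ_of_expanding hL hN fun n => by
    have e : ((v (n + 2) - v (n + 1) : ℝ) : UnitAddCircle) =
        ((N * (v (n + 1) - v n) : ℝ) : UnitAddCircle) := by
      have e1 : ∀ m k, ((v m - v k : ℝ) : UnitAddCircle) = X m - X k := fun m k => by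
        rw [← hwv, ← hwv, ← AddCircle.coe_sub]; congr 1; ring
      rw [← nsmul_eq_mul, AddCircle.coe_nsmul, e1, e1, smul_sub, ← hsucc, ← hsucc]
    exact coe_circle_eq_coe_iff.1 e
  exact hvne n hn

theorem isRationalAngle_of_nsmul_eq_zero {θ : UnitAddCircle} {M : ℕ} (hM : 0 < M)
    (h : M • θ = 0) : IsRationalAngle θ := by
  obtain ⟨y, -, rfl⟩ := exists_coe_eq_mem_Ico 0 θ
  rw [← AddCircle.coe_nsmul, AddCircle.coe_eq_zero_iff] at h
  obtain ⟨k, hk⟩ := h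
  refine ⟨k / M, ?_⟩
  congr 1
  simp only [zsmul_eq_mul, mul_one, nsmul_eq_mul] at hk
  push_cast
  rw [hk]
  field_simp

theorem IsRationalAngle.exists_nsmul_eq_zero {θ : UnitAddCircle} (h : IsRationalAngle θ) :
    ∃ M : ℕ, 0 < M ∧ M • θ = 0 := by
  obtain ⟨q, rfl⟩ := h
  refine ⟨q.den, q.pos, ?_⟩
  rw [← AddCircle.coe_nsmul, AddCircle.coe_eq_zero_iff]
  refine ⟨q.num, ?_⟩
  rw [zsmul_eq_mul, mul_one, nsmul_eq_mul]
  exact_mod_cast (Rat.den_mul_eq_num q).symm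

/-- The orbit of a rational angle under multiplication by `d` is eventually periodic. -/
theorem IsRationalAngle.exists_periodic {θ : UnitAddCircle} (h : IsRationalAngle θ) (d : ℕ) :
    ∃ m n : ℕ, 0 < n ∧ d ^ n • (d ^ m • θ) = d ^ m • θ := by
  obtain ⟨M, hM, hMθ⟩ := h.exists_nsmul_eq_zero
  have hfin := AddCircle.finite_torsion (1 : ℝ) hM
  obtain ⟨m, n, hmn, he⟩ := hfin.exists_lt_map_eq_of_forall_mem (f := fun n : ℕ => d ^ n • θ)
    fun n => by
      change M • d ^ n • θ = 0
      rw [smul_comm, hMθ, smul_zero]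
  refine ⟨m, n - m, by omega, ?_⟩
  rw [smul_smul, ← pow_add, Nat.sub_add_cancel hmn.le]
  exact he.symm

end Circle

/-! ### The angles of the rays that land at a point -/

section Portrait

variable {d : ℕ} {c : ℂ}

theorem rotation_mul_ne (hd : 2 ≤ d) {z : ℂ} (hz : z ≠ 0) : z ≠ rotation d * z := fun h =>
  (isPrimitiveRoot_rotation hd).ne_one hd (mul_right_cancel₀ hz (by rw [one_mul, ← h]))

/-- The lifts of two angles of rays landing at `z ≠ 0` do not differ by a number in
`[1 / d, 1 - 1 / d]`. -/
theorem not_gap {z : ℂ} (hd : 2 ≤ d) (hz : z ≠ 0) {x y : ℝ}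
    (hx : RayLandsAt d c (x : UnitAddCircle) z) (hy : RayLandsAt d c (y : UnitAddCircle) z)
    (h1 : 1 / (d : ℝ) ≤ y - x) (h2 : y - x ≤ 1 - 1 / (d : ℝ)) : False := by
  have hne := rotation_mul_ne hd hz
  have hx' := hx.rotate hd
  have hy' := hy.rotate hd
  rw [← AddCircle.coe_add] at hx' hy'
  have hd0 : 0 < 1 / (d : ℝ) := by
    have : (0 : ℝ) < d := by exact_mod_cast (by omega : 0 < d)
    positivity
  -- At either end of the range a rotated angle coincides with an angle at `z`; strictly inside, `x
  -- < x + 1/d < y < y + 1/d < x + 1` is a linked pattern.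
  rcases h1.eq_or_lt with h | h
  · rw [show x + 1 / (d : ℝ) = y by linarith] at hx'
    exact hne (hy.unique hx')
  rcases h2.eq_or_lt with h' | h'
  · have : ((y + 1 / (d : ℝ) : ℝ) : UnitAddCircle) = (x : UnitAddCircle) :=
      coe_circle_eq_coe_iff.2 ⟨1, by push_cast; linarith⟩
    rw [this] at hy'
    exact hne (hx.unique hy')
  exact not_linked hd hne hx hy hx' hy' (by linarith) (by linarith) (by linarith) (by linarith)

/-- The triangle inequality gives only `2 / d`. By `not_gap` a difference of at least `1 / d`
exceeds `1 - 1 / d`, which leaves `d = 2`; in that case the rotated angles `v + 1/2` and `a + 1/2`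
are linked with `a` and `u`. -/
theorem abs_sub_lt_of_lifts {z : ℂ} (hd : 2 ≤ d) (hz : z ≠ 0) {a u v : ℝ}
    (ha : RayLandsAt d c (a : UnitAddCircle) z) (hu : RayLandsAt d c (u : UnitAddCircle) z)
    (hv : RayLandsAt d c (v : UnitAddCircle) z) (hua : |u - a| < 1 / (d : ℝ))
    (hva : |v - a| < 1 / (d : ℝ)) : |u - v| < 1 / (d : ℝ) := by
  wlog h : v ≤ u generalizing u v
  · rw [abs_sub_comm]; exact this hv hu hva hua (le_of_not_ge h)
  rw [abs_of_nonneg (by linarith)]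
  by_contra! hge
  have hgt : 1 - 1 / (d : ℝ) < u - v := by
    by_contra! hle
    exact not_gap hd hz hv hu hge hle
  rw [abs_lt] at hua hva
  have hd3 : d = 2 := by
    have h3 : 1 < 3 / (d : ℝ) := by
      rw [show (3 : ℝ) / d = 3 * (1 / d) by ring]; linarith [hua.2, hva.1]
    have hdpos : (0 : ℝ) < d := by exact_mod_cast (by omega : 0 < d)
    rw [lt_div_iff₀ hdpos, one_mul] at h3
    have : d < 3 := by exact_mod_cast h3
    omega
  have ha' := ha.rotate hd
  have hv' := hv.rotate hd
  rw [← AddCircle.coe_add] at ha' hv'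
  rw [hd3] at hgt hua hva
  norm_num at hgt hua hva
  have e : (1 : ℝ) / d = 1 / 2 := by rw [hd3]; norm_num
  exact not_linked hd (rotation_mul_ne hd hz) ha hu hv' ha'
    (by rw [e]; linarith) (by rw [e]; linarith) (by rw [e]; linarith) (by rw [e]; linarith)

/-- The angles of the rays landing at `z ≠ 0` have lifts that pairwise differ by less than
`1 / d`. -/
theorem exists_lift {z : ℂ} (hd : 2 ≤ d) (hz : z ≠ 0) :
    ∃ ℓ : UnitAddCircle → ℝ, (∀ θ ∈ landingAngles d c z, (ℓ θ : UnitAddCircle) = θ) ∧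
      ∀ θ ∈ landingAngles d c z, ∀ θ' ∈ landingAngles d c z, |ℓ θ - ℓ θ'| < 1 / (d : ℝ) := by
  rcases (landingAngles d c z).eq_empty_or_nonempty with he | ⟨θ₀, hθ₀⟩
  · exact ⟨fun _ => 0, by simp [he]⟩
  obtain ⟨a, -, ha⟩ := exists_coe_eq_mem_Ico 0 θ₀
  have hal : RayLandsAt d c (a : UnitAddCircle) z := ha ▸ hθ₀
  -- Centring the window at `a` keeps the distance to `a` at most `1 / 2 ≤ 1 - 1 / d`, so `not_gap`
  -- pushes it below `1 / d`.
  choose ℓ hℓ hℓc using exists_coe_eq_mem_Ico (a - 1 / 2)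
  have hd2 : 1 / (d : ℝ) ≤ 1 / 2 := by
    have : (2 : ℝ) ≤ d := by exact_mod_cast hd
    gcongr
  have hlands : ∀ θ ∈ landingAngles d c z, RayLandsAt d c (ℓ θ : UnitAddCircle) z :=
    fun θ hθ => (hℓc θ).symm ▸ hθ
  have hclose : ∀ θ ∈ landingAngles d c z, |ℓ θ - a| < 1 / (d : ℝ) := fun θ hθ => by
    have := hℓ θ
    rw [mem_Ico] at this
    rw [abs_sub_lt_iff]
    constructor <;> by_contra! hge
    · exact not_gap hd hz hal (hlands θ hθ) hge (by linarith)
    · exact not_gap hd hz (hlands θ hθ) hal hge (by linarith)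
  exact ⟨ℓ, fun θ _ => hℓc θ, fun θ hθ θ' hθ' => abs_sub_lt_of_lifts hd hz hal (hlands θ hθ)
    (hlands θ' hθ') (hclose θ hθ) (hclose θ' hθ')⟩

theorem abs_mul_sub_mul_lt_one (hd : 2 ≤ d) {x y : ℝ} (h : |x - y| < 1 / (d : ℝ)) :
    |(d : ℝ) * x - d * y| < 1 := by
  have hd0 : (0 : ℝ) < d := by exact_mod_cast (by omega : 0 < d)
  rw [← mul_sub, abs_mul, abs_of_pos hd0, mul_comm]
  rwa [lt_div_iff₀ hd0] at h

theorem one_div_lt_one (hd : 2 ≤ d) : 1 / (d : ℝ) < 1 := by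
  rw [div_lt_one (by exact_mod_cast (by omega : 0 < d))]
  exact_mod_cast (by omega : 1 < d)

/-- Multiplication by `d` takes the lifts of `exists_lift` to numbers at mutual distance less than
`1`, where congruence modulo `1` is equality. The same remark gives the cyclic order in
`sbtw_smul_iff`. -/
theorem injOn_smul_landingAngles {z : ℂ} (hd : 2 ≤ d) (hz : z ≠ 0) :
    InjOn (fun θ : UnitAddCircle => d • θ) (landingAngles d c z) := by
  obtain ⟨ℓ, hℓ, hlt⟩ := exists_lift (c := c) hd hz
  intro θ hθ θ' hθ' h
  simp only at h
  rw [← hℓ θ hθ, ← hℓ θ' hθ', ← AddCircle.coe_nsmul, ← AddCircle.coe_nsmul, nsmul_eq_mul,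
    nsmul_eq_mul] at h
  have := eq_of_coe_circle_eq h (abs_mul_sub_mul_lt_one hd (hlt θ hθ θ' hθ'))
  have hd0 : (d : ℝ) ≠ 0 := by exact_mod_cast (by omega : d ≠ 0)
  rw [← hℓ θ hθ, ← hℓ θ' hθ', mul_left_cancel₀ hd0 this]

theorem sbtw_smul_iff {z : ℂ} (hd : 2 ≤ d) (hz : z ≠ 0) {θ₁ θ₂ θ₃ : UnitAddCircle}
    (h₁ : θ₁ ∈ landingAngles d c z) (h₂ : θ₂ ∈ landingAngles d c z)
    (h₃ : θ₃ ∈ landingAngles d c z) :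
    sbtw (d • θ₁) (d • θ₂) (d • θ₃) ↔ sbtw θ₁ θ₂ θ₃ := by
  obtain ⟨ℓ, hℓ, hlt⟩ := exists_lift (c := c) hd hz
  have hd1 := one_div_lt_one hd
  have hd0 : (0 : ℝ) < d := by exact_mod_cast (by omega : 0 < d)
  have a12 := hlt _ h₁ _ h₂
  have a23 := hlt _ h₂ _ h₃
  have a13 := hlt _ h₁ _ h₃
  have e₁ := hℓ _ h₁
  have e₂ := hℓ _ h₂
  have e₃ := hℓ _ h₃
  generalize ℓ θ₁ = x at *
  generalize ℓ θ₂ = y at *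
  generalize ℓ θ₃ = w at *
  subst e₁ e₂ e₃
  simp only [← AddCircle.coe_nsmul, nsmul_eq_mul]
  rw [sbtw_coe_iff (abs_mul_sub_mul_lt_one hd a12) (abs_mul_sub_mul_lt_one hd a23)
    (abs_mul_sub_mul_lt_one hd a13), sbtw_coe_iff (a12.trans hd1) (a23.trans hd1) (a13.trans hd1)]
  simp only [mul_lt_mul_iff_right₀ hd0]

/-- Finitely many rays landing at `z ≠ 0` have their angles in an arc of length less than
`1 / d`. -/
theorem exists_arc {z : ℂ} (hd : 2 ≤ d) (hz : z ≠ 0) (hfin : (landingAngles d c z).Finite) :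
    ∃ a b : ℝ, a < b ∧ b - a < 1 / (d : ℝ) ∧ landingAngles d c z ⊆ arc a b := by
  obtain ⟨ℓ, hℓ, hlt⟩ := exists_lift (c := c) hd hz
  have hd0 : 0 < 1 / (d : ℝ) := by
    have : (0 : ℝ) < d := by exact_mod_cast (by omega : 0 < d)
    positivity
  rcases (landingAngles d c z).eq_empty_or_nonempty with he | hne
  · exact ⟨0, 1 / d / 2, by linarith, by linarith, by simp [he]⟩
  obtain ⟨θm, hm, hmin⟩ := Set.exists_min_image _ ℓ hfin hne
  obtain ⟨θM, hM, hmax⟩ := Set.exists_max_image _ ℓ hfin hne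
  have hlen := (le_abs_self _).trans_lt (hlt _ hM _ hm)
  have hle := hmin _ hM
  -- A third of the spare length is added at each end to make the arc open, so the total stays below
  -- `1 / d`.
  set ε := (1 / (d : ℝ) - (ℓ θM - ℓ θm)) / 3 with hε
  have hε0 : 0 < ε := by rw [hε]; linarith
  refine ⟨ℓ θm - ε, ℓ θM + ε, by linarith, by linarith, fun θ hθ => ⟨ℓ θ, ⟨?_, ?_⟩, hℓ θ hθ⟩⟩
  · linarith [hmin θ hθ]
  · linarith [hmax θ hθ]

theorem iterate_fixed {p : ℕ} {z : ℂ} (hz : (f d c)^[p] z = z) (n : ℕ) :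
    (f d c)^[p] ((f d c)^[n] z) = (f d c)^[n] z := by
  rw [← Function.iterate_add_apply, add_comm, Function.iterate_add_apply, hz]

theorem injOn_pow_smul {p : ℕ} (hp : 0 < p) {z : ℂ} (hd : 2 ≤ d) (hz : (f d c)^[p] z = z)
    (n : ℕ) : InjOn (fun θ : UnitAddCircle => d ^ n • θ) (landingAngles d c z) := by
  induction n with
  | zero => intro θ _ θ' _ h; simpa using h
  | succ n ih =>
    intro θ hθ θ' hθ' h
    simp only [pow_succ', mul_smul] at h
    have h1 : RayLandsAt d c (d ^ n • θ) ((f d c)^[n] z) := RayLandsAt.iterate hd hθ n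
    have h2 : RayLandsAt d c (d ^ n • θ') ((f d c)^[n] z) := RayLandsAt.iterate hd hθ' n
    exact ih hθ hθ' (injOn_smul_landingAngles hd (h1.ne_zero hd hp (iterate_fixed hz n)) h1 h2 h)

theorem sbtw_pow_smul_iff {p : ℕ} (hp : 0 < p) {z : ℂ} (hd : 2 ≤ d) (hz : (f d c)^[p] z = z)
    (n : ℕ) {θ₁ θ₂ θ₃ : UnitAddCircle}
    (h₁ : θ₁ ∈ landingAngles d c z) (h₂ : θ₂ ∈ landingAngles d c z)
    (h₃ : θ₃ ∈ landingAngles d c z) :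
    sbtw (d ^ n • θ₁) (d ^ n • θ₂) (d ^ n • θ₃) ↔ sbtw θ₁ θ₂ θ₃ := by
  induction n with
  | zero => simp
  | succ n ih =>
    simp only [pow_succ', mul_smul]
    have e₁ : RayLandsAt d c (d ^ n • θ₁) ((f d c)^[n] z) := RayLandsAt.iterate hd h₁ n
    rw [← ih]
    exact sbtw_smul_iff hd (e₁.ne_zero hd hp (iterate_fixed hz n)) e₁
      (RayLandsAt.iterate hd h₂ n) (RayLandsAt.iterate hd h₃ n)

/-- If `d ^ n` fixes one of the angles of the rays landing at a point that is fixed by the `n`-th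
iterate, then it fixes all of them. -/
theorem pow_smul_eq_of_pow_smul_eq {n : ℕ} (hn : 0 < n) {z : ℂ} (hd : 2 ≤ d)
    (hz : (f d c)^[n] z = z) {θ : UnitAddCircle} (hθ : θ ∈ landingAngles d c z)
    (hfix : d ^ n • θ = θ) {x : UnitAddCircle} (hx : x ∈ landingAngles d c z) : d ^ n • x = x := by
  refine smul_eq_of_sbtw_preserving (Nat.one_le_pow _ _ (by omega)) (fun y hy => ?_)
    (injOn_pow_smul hn hd hz n)
    (fun θ₁ h₁ θ₂ h₂ θ₃ h₃ h => (sbtw_pow_smul_iff hn hd hz n h₁ h₂ h₃).2 h) hθ hfix hx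
  have : RayLandsAt d c (d ^ n • y) ((f d c)^[n] z) := RayLandsAt.iterate hd hy n
  rwa [hz] at this

theorem nsmul_eq_zero_of_pow_smul_eq {n : ℕ} (hn : 0 < n) (hd : 2 ≤ d) {x : UnitAddCircle}
    (h : d ^ n • x = x) : 0 < d ^ n - 1 ∧ (d ^ n - 1) • x = 0 := by
  have h1 : 1 < d ^ n := Nat.one_lt_pow hn.ne' (by omega)
  refine ⟨by omega, ?_⟩
  have h2 : (d ^ n - 1 + 1) • x = x := by rwa [Nat.sub_add_cancel h1.le]
  rwa [add_smul, one_smul, add_eq_right] at h2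

/-- Finite sets of angles of rays landing at distinct points are unlinked. -/
theorem unlinked_of_rayLandsAt {z w : ℂ} (hd : 2 ≤ d) (hzw : z ≠ w) {S T : Set UnitAddCircle}
    (hT : T.Finite) (hSz : ∀ θ ∈ S, RayLandsAt d c θ z) (hTw : ∀ θ ∈ T, RayLandsAt d c θ w) :
    Unlinked S T := by
  rcases T.eq_empty_or_nonempty with rfl | hTne
  · exact ⟨univ, ∅, isPreconnected_univ, isPreconnected_empty, disjoint_empty _, subset_univ _,
      le_rfl⟩
  rcases S.eq_empty_or_nonempty with rfl | ⟨θ₀, hθ₀⟩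
  · exact ⟨∅, univ, isPreconnected_empty, isPreconnected_univ, empty_disjoint _, le_rfl,
      subset_univ _⟩
  have hdisj : ∀ θ ∈ S, θ ∉ T := fun θ hS hT => hzw ((hSz θ hS).unique (hTw θ hT))
  obtain ⟨a, -, ha⟩ := exists_coe_eq_mem_Ico 0 θ₀
  choose ℓ hℓ hℓc using exists_coe_eq_mem_Ico a
  have hTne' : ∀ θ ∈ T, ∀ σ : ℝ, (σ : UnitAddCircle) ∈ S → σ ≠ ℓ θ := fun θ hθ σ hσ h =>
    hdisj _ hσ (by rw [h, hℓc]; exact hθ)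
  have haS : (a : UnitAddCircle) ∈ S := ha ▸ hθ₀
  obtain ⟨θm, hm, hmin⟩ := Set.exists_min_image _ ℓ hT hTne
  obtain ⟨θM, hM, hmax⟩ := Set.exists_max_image _ ℓ hT hTne
  have ham : a < ℓ θm := lt_of_le_of_ne (hℓ θm).1 (hTne' θm hm a haS)
  have hMa := (hℓ θM).2
  have hcont : Continuous fun x : ℝ => (x : UnitAddCircle) := AddCircle.continuous_mk' 1
  -- `T` fills the closed arc between its extreme lifts, and `S` must lie in the complementary open
  -- arc: an angle of `S` between the extremes of `T` would, together with `a`, be linked with them.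
  refine ⟨(fun x : ℝ => (x : UnitAddCircle)) '' Ioo (ℓ θM) (ℓ θm + 1),
    (fun x : ℝ => (x : UnitAddCircle)) '' Icc (ℓ θm) (ℓ θM),
    isPreconnected_Ioo.image _ hcont.continuousOn, isPreconnected_Icc.image _ hcont.continuousOn,
    ?_, fun s hs => ?_, fun θ hθ => ⟨ℓ θ, ⟨hmin θ hθ, hmax θ hθ⟩, hℓc θ⟩⟩
  · rw [Set.disjoint_left]
    rintro _ ⟨x, hx, rfl⟩ ⟨y, hy, h⟩
    have := eq_of_coe_circle_eq h (by
      rw [abs_sub_lt_iff]; constructor <;> linarith [hx.1, hx.2, hy.1, hy.2])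
    linarith [hx.1, hy.2]
  · have hσS : ((ℓ s : ℝ) : UnitAddCircle) ∈ S := by rw [hℓc]; exact hs
    have hσ := hℓ s
    rw [mem_Ico] at hσ
    rcases lt_or_gt_of_ne (hTne' θm hm _ hσS) with h | h
    · refine ⟨ℓ s + 1, ⟨by linarith, by linarith⟩, ?_⟩
      change ((ℓ s + 1 : ℝ) : UnitAddCircle) = s
      rw [AddCircle.coe_add, AddCircle.coe_period, add_zero, hℓc]
    rcases lt_or_gt_of_ne (hTne' θM hM _ hσS) with h' | h'
    · refine (not_linked hd hzw (hSz _ haS) (hSz _ hσS) (?_ : RayLandsAt d c (ℓ θm) w)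
        (?_ : RayLandsAt d c (ℓ θM) w) ham h h' hMa).elim
      · rw [hℓc]; exact hTw _ hm
      · rw [hℓc]; exact hTw _ hM
    · exact ⟨ℓ s, ⟨h', by linarith⟩, hℓc s⟩

theorem f_rotation_pow_mul (hd : 2 ≤ d) (j : ℕ) (z : ℂ) :
    f d c (rotation d ^ j * z) = f d c z := by
  rw [f, f, mul_pow, ← pow_mul, mul_comm j d, pow_mul, rotation_pow hd, one_pow, one_mul]

theorem IsPeriodicOrbit.iterate {p : ℕ} {z : ZMod p → ℂ} (hz : IsPeriodicOrbit d c p z)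
    (j : ZMod p) (n : ℕ) : (f d c)^[n] (z j) = z (j + n) := by
  induction n with
  | zero => simp
  | succ n ih => rw [Function.iterate_succ_apply', ih, hz.map]; congr 1; push_cast; ring

theorem IsPeriodicOrbit.iterate_mul {p : ℕ} {z : ZMod p → ℂ} (hz : IsPeriodicOrbit d c p z)
    (j : ZMod p) (q : ℕ) : (f d c)^[q * p] (z j) = z j := by
  rw [hz.iterate]; simp

/-- If a rational ray lands on the orbit, then a periodic ray lands at each point of it. -/
theorem IsPeriodicOrbit.exists_periodic_angle {p : ℕ} {z : ZMod p → ℂ} (hd : 2 ≤ d)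
    (hz : IsPeriodicOrbit d c p z)
    (hray : ∃ (j : ZMod p) (t : UnitAddCircle), IsRationalAngle t ∧ RayLandsAt d c t (z j))
    (i : ZMod p) : ∃ q : ℕ, 0 < q ∧ ∃ θ ∈ landingAngles d c (z i), d ^ (q * p) • θ = θ := by
  have := NeZero.of_pos hz.pos
  obtain ⟨j, t, ht, hl⟩ := hray
  -- After `m` steps the angle has period `n`; `k` further steps bring its landing point to `z i`.
  -- The exponent `n * p` is a period of both the angle and the point.
  obtain ⟨m, n, hn, he⟩ := ht.exists_periodic d
  set k : ℕ := (i - j - m : ZMod p).val with hk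
  refine ⟨n, hn, d ^ (k + m) • t, ?_, ?_⟩
  · have h := hl.iterate hd (k + m)
    have hk' : ((k : ℕ) : ZMod p) = i - j - m := by rw [hk, ZMod.natCast_zmod_val]
    rw [hz.iterate, Nat.cast_add, hk', show j + (i - j - m + m) = i by ring] at h
    exact h
  · have hmul : ∀ l : ℕ, d ^ (n * l) • (d ^ m • t) = d ^ m • t := fun l => by
      induction l with
      | zero => simp
      | succ l ih => rw [Nat.mul_succ, pow_add, mul_smul, he, ih]
    rw [pow_add d k m, mul_smul, smul_comm, hmul p]

theorem isPeriodicPt_smul_iff {n : ℕ} {θ : UnitAddCircle} :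
    Function.IsPeriodicPt (fun t : UnitAddCircle => d • t) n θ ↔ d ^ n • θ = θ := by
  rw [Function.IsPeriodicPt, Function.IsFixedPt, smul_iterate]

theorem iterate_smul_eq (n : ℕ) (θ : UnitAddCircle) :
    (fun t : UnitAddCircle => d • t)^[n] θ = d ^ n • θ := by rw [smul_iterate]

end Portrait

end Unicritical

end

/-! ### The orbit portrait theorem -/

theorem mainTheorem12 (d : ℕ) (hd : 2 ≤ d) (c : ℂ) (p : ℕ) (z : ZMod p → ℂ)
    (hz : Unicritical.IsPeriodicOrbit d c p z)
    (hray : ∃ (j : ZMod p) (t : UnitAddCircle),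
      Unicritical.IsRationalAngle t ∧ Unicritical.RayLandsAt d c t (z j)) :
    -- each set of the portrait is a non-empty finite set of rational angles
    (∀ j, (Unicritical.orbitPortrait d c z j).Nonempty ∧
      (Unicritical.orbitPortrait d c z j).Finite ∧
      ∀ θ ∈ Unicritical.orbitPortrait d c z j, Unicritical.IsRationalAngle θ) ∧
    -- multiplication by `d` is a bijection of consecutive sets that preserves the cyclic order
    (∀ j, Set.BijOn (fun θ : UnitAddCircle => d • θ)
        (Unicritical.orbitPortrait d c z j) (Unicritical.orbitPortrait d c z (j + 1)) ∧
      ∀ θ₁ ∈ Unicritical.orbitPortrait d c z j, ∀ θ₂ ∈ Unicritical.orbitPortrait d c z j,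
        ∀ θ₃ ∈ Unicritical.orbitPortrait d c z j,
          (sbtw (d • θ₁) (d • θ₂) (d • θ₃) ↔ sbtw θ₁ θ₂ θ₃)) ∧
    -- each set lies in an arc of length less than `1 / d`
    (∀ j, ∃ a b : ℝ, a < b ∧ b - a < 1 / (d : ℝ) ∧
      Unicritical.orbitPortrait d c z j ⊆ Unicritical.arc a b) ∧
    -- all angles are periodic with a common exact period `r * p`
    (∃ r : ℕ, 1 ≤ r ∧ ∀ j, ∀ θ ∈ Unicritical.orbitPortrait d c z j,
      Function.minimalPeriod (fun t : UnitAddCircle => d • t) θ = r * p) ∧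
    -- the translates of a set are unlinked from each other and from the other sets
    (∀ i, (∀ j < d, ∀ k < d, j ≠ k →
        Unicritical.Unlinked
          (Unicritical.translate d j (Unicritical.orbitPortrait d c z i))
          (Unicritical.translate d k (Unicritical.orbitPortrait d c z i))) ∧
      ∀ j < d, ∀ m, m ≠ i →
        Unicritical.Unlinked
          (Unicritical.translate d j (Unicritical.orbitPortrait d c z i))
          (Unicritical.orbitPortrait d c z m)) := by
  open Unicritical in
  have hp := hz.pos
  have := NeZero.of_pos hp
  simp only [orbitPortrait]
  have hper : ∀ i, (f d c)^[p] (z i) = z i := fun i => by simpa using hz.iterate_mul i 1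
  have hangle := hz.exists_periodic_angle hd hray
  -- One periodic angle at `z i` forces its period on all the angles there, without assuming
  -- finiteness.
  have hfix : ∀ i, ∃ q : ℕ, 0 < q ∧ ∀ x ∈ landingAngles d c (z i), d ^ (q * p) • x = x :=
    fun i => by
      obtain ⟨q, hq, θ, hθ, h⟩ := hangle i
      exact ⟨q, hq, fun x hx => pow_smul_eq_of_pow_smul_eq (Nat.mul_pos hq hp) hd
        (hz.iterate_mul i q) hθ h hx⟩
  have hne0 : ∀ i, z i ≠ 0 := fun i => by
    obtain ⟨q, hq, θ, hθ, h⟩ := hangle i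
    exact RayLandsAt.ne_zero hd hθ hp (hper i)
  have hfin : ∀ i, (landingAngles d c (z i)).Finite := fun i => by
    obtain ⟨q, hq, h⟩ := hfix i
    have hpos : 0 < d ^ (q * p) - 1 := by
      have := Nat.one_lt_pow (Nat.mul_pos hq hp).ne' (by omega : 1 < d)
      omega
    exact (AddCircle.finite_torsion (1 : ℝ) hpos).subset fun x hx =>
      (nsmul_eq_zero_of_pow_smul_eq (Nat.mul_pos hq hp) hd (h x hx)).2
  have hmap : ∀ i, ∀ θ ∈ landingAngles d c (z i), d • θ ∈ landingAngles d c (z (i + 1)) :=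
    fun i θ hθ => by
      have : RayLandsAt d c (d • θ) (f d c (z i)) := RayLandsAt.map hd hθ
      rwa [hz.map] at this
  refine ⟨fun i => ⟨?_, hfin i, fun θ hθ => ?_⟩, fun i => ⟨⟨hmap i, ?_, fun y hy => ?_⟩, ?_⟩,
    fun i => exists_arc hd (hne0 i) (hfin i), ?_, fun i => ⟨fun j hj k hk hjk => ?_,
      fun j hj m hm => ?_⟩⟩
  · obtain ⟨q, hq, θ, hθ, h⟩ := hangle i
    exact ⟨θ, hθ⟩
  · obtain ⟨q, hq, h⟩ := hfix i
    obtain ⟨h1, h2⟩ := nsmul_eq_zero_of_pow_smul_eq (Nat.mul_pos hq hp) hd (h θ hθ)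
    exact isRationalAngle_of_nsmul_eq_zero h1 h2
  · exact injOn_smul_landingAngles hd (hne0 i)
  · obtain ⟨q, hq, h⟩ := hfix (i + 1)
    obtain ⟨n, hn⟩ := Nat.exists_eq_add_of_le' (Nat.mul_pos hq hp : 1 ≤ q * p)
    -- With `n = q * p - 1`, going almost once around the period of `y` gives its preimage.
    refine ⟨d ^ n • y, ?_, ?_⟩
    · have hy' : RayLandsAt d c (d ^ n • y) ((f d c)^[n] (z (i + 1))) := RayLandsAt.iterate hd hy n
      have e : i + 1 + (n : ZMod p) = i := by
        have : ((n + 1 : ℕ) : ZMod p) = 0 := by rw [← hn]; simp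
        push_cast at this
        rw [add_assoc, add_comm 1 (n : ZMod p), this, add_zero]
      rw [hz.iterate, e] at hy'
      exact hy'
    · have := h y hy
      rwa [hn, pow_succ', mul_smul] at this
  · exact fun θ₁ h₁ θ₂ h₂ θ₃ h₃ => sbtw_smul_iff hd (hne0 i) h₁ h₂ h₃
  · have hperiodic : ∀ i, ∀ θ ∈ landingAngles d c (z i),
        θ ∈ Function.periodicPts (fun t : UnitAddCircle => d • t) := fun i θ hθ => by
      obtain ⟨q, hq, h⟩ := hfix i
      exact ⟨q * p, Nat.mul_pos hq hp, isPeriodicPt_smul_iff.2 (h θ hθ)⟩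
    -- When the angle returns, so does its landing point, and the points of the orbit are distinct.
    have hdvd : ∀ i, ∀ θ ∈ landingAngles d c (z i),
        p ∣ Function.minimalPeriod (fun t : UnitAddCircle => d • t) θ := fun i θ hθ => by
      have h1 := isPeriodicPt_smul_iff.1
        (Function.isPeriodicPt_minimalPeriod (fun t : UnitAddCircle => d • t) θ)
      have h2 := RayLandsAt.iterate hd hθ
        (Function.minimalPeriod (fun t : UnitAddCircle => d • t) θ)
      rw [h1, hz.iterate] at h2
      have h3 := hz.injective (RayLandsAt.unique hθ h2)
      rw [left_eq_add] at h3
      exact (ZMod.natCast_eq_zero_iff _ _).1 h3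
    have hsame : ∀ i, ∀ θ ∈ landingAngles d c (z i), ∀ θ' ∈ landingAngles d c (z i),
        Function.minimalPeriod (fun t : UnitAddCircle => d • t) θ' ∣
          Function.minimalPeriod (fun t : UnitAddCircle => d • t) θ := fun i θ hθ θ' hθ' => by
      obtain ⟨k, hk⟩ := hdvd i θ hθ
      have hpos := Function.minimalPeriod_pos_of_mem_periodicPts (hperiodic i θ hθ)
      have h1 := isPeriodicPt_smul_iff.1
        (Function.isPeriodicPt_minimalPeriod (fun t : UnitAddCircle => d • t) θ)
      refine Function.IsPeriodicPt.minimalPeriod_dvd (isPeriodicPt_smul_iff.2 ?_)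
      refine pow_smul_eq_of_pow_smul_eq hpos hd ?_ hθ h1 hθ'
      rw [hk, mul_comm]
      exact hz.iterate_mul i k
    obtain ⟨-, -, θ₀, hθ₀, -⟩ := hangle 0
    obtain ⟨r, hr⟩ := hdvd 0 θ₀ hθ₀
    have hpos := Function.minimalPeriod_pos_of_mem_periodicPts (hperiodic 0 θ₀ hθ₀)
    refine ⟨r, ?_, fun i θ hθ => ?_⟩
    · rw [hr] at hpos
      exact Nat.pos_of_mul_pos_left hpos
    -- The image of `θ₀` at `z i` has the same exact period as `θ₀`, which carries the common period
    -- from `z 0` to every point.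
    · have h1 : RayLandsAt d c (d ^ i.val • θ₀) ((f d c)^[i.val] (z 0)) :=
        RayLandsAt.iterate hd hθ₀ i.val
      rw [hz.iterate, zero_add, ZMod.natCast_zmod_val] at h1
      rw [Nat.dvd_antisymm (hsame i _ h1 _ hθ) (hsame i _ hθ _ h1), ← iterate_smul_eq,
        Function.minimalPeriod_apply_iterate (hperiodic 0 θ₀ hθ₀), hr, mul_comm]
  · refine unlinked_of_rayLandsAt (c := c) (z := rotation d ^ j * z i) (w := rotation d ^ k * z i)
      hd (fun h => hjk ?_) ((hfin i).image _) ?_ ?_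
    · exact (isPrimitiveRoot_rotation hd).pow_inj hj hk (mul_right_cancel₀ (hne0 i) h)
    · rintro _ ⟨θ, hθ, rfl⟩
      exact RayLandsAt.rotate_iterate hd hθ j
    · rintro _ ⟨θ, hθ, rfl⟩
      exact RayLandsAt.rotate_iterate hd hθ k
  · refine unlinked_of_rayLandsAt (c := c) (z := rotation d ^ j * z i) (w := z m)
      hd (fun h => hm ?_) (hfin m) ?_ fun θ hθ => hθ
    -- A rotate of `z i` has the same image as `z i`, so if it were `z m`, injectivity on the orbit
    -- would give `m = i`.
    · have h1 := congrArg (f d c) h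
      rw [f_rotation_pow_mul hd, hz.map, hz.map] at h1
      exact (add_right_cancel (hz.injective h1)).symm
    · rintro _ ⟨θ, hθ, rfl⟩
      exact RayLandsAt.rotate_iterate hd hθ j
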